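/- Let $n\ge 0$. Let $\mathbb Z[\tfrac12,i]$ be the smallest subring of $\mathbb C$ containing $\tfrac12$ and $i$, and let $U_n(\mathbb Z[\tfrac12,i])$ be the group of unitary $n\times n$ matrices with entries in it; rows and columns are numbered $0,\dots,n-1$. Put $$X=\begin{bmatrix}0&1\\1&0\end{bmatrix},\qquad K=\frac1{1+i}\begin{bmatrix}1&1\\1&-1\end{bmatrix}=\omega^\dagger H,\quad\text{where } \omega=\tfrac{1+i}{\sqrt2},\ H=\tfrac1{\sqrt2}\begin{bmatrix}1&1\\1&-1\end{bmatrix}.$$ For $0\le j<n$ let $i_{[j]}$ be the $n\times n$ matrix that agrees with the identity except that its $(j,j)$ entry is $i$. For $0\le j<k<n$ and a $2\times2$ matrix $U=\begin{bmatrix}a&b\\c&d\end{bmatrix}$ let $U_{[j,k]}$ be the $n\times n$ matrix that agrees with the identity except that its entries at $(j,j),(j,k),(k,j),(k,k)$ are $a,b,c,d$ respectively. Let $\mathcal G$ be the set of all matrices $X_{[j,k]}$, $K_{[j,k]}$ ($0\le j<k<n$) and $i_{[j]}$ ($0\le j<n$), let $\mathcal G^*$ be the monoid of words over $\mathcal G$,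 with empty word $\varepsilon$, and for $w\in\mathcal G^*$ let $[\![w]\!]$ be the product in $U_n(\mathbb Z[\tfrac12,i])$ of the letters of $w$. Let $\mathcal R$ be the set of the following relations on $\mathcal G^*$, for all indices in $\{0,\dots,n-1\}$ such that the indices named in a relation are distinct and $a<b$ whenever a generator $X_{[a,b]}$ or $K_{[a,b]}$ occurs in it: 1. $i_{[j]}^4\sim\varepsilon$ 2. $X_{[j,k]}^2\sim\varepsilon$ 3. $K_{[j,k]}^8\sim\varepsilon$ 4. $i_{[j]}i_{[k]}\sim i_{[k]}i_{[j]}$ 5. $i_{[j]}X_{[k,\ell]}\sim X_{[k,\ell]}i_{[j]}$ 6. $i_{[j]}K_{[k,\ell]}\sim K_{[k,\ell]}i_{[j]}$ 7. $X_{[j,k]}X_{[\ell,m]}\sim X_{[\ell,m]}X_{[j,k]}$ 8. $X_{[j,k]}K_{[\ell,m]}\sim K_{[\ell,m]}X_{[j,k]}$ 9. $K_{[j,k]}K_{[\ell,m]}\sim K_{[\ell,m]}K_{[j,k]}$ 10. $i_{[k]}X_{[j,k]}\sim X_{[j,k]}i_{[j]}$ 11. $X_{[k,\ell]}X_{[j,k]}\sim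 X_{[j,k]}X_{[j,\ell]}$ 12. $X_{[j,\ell]}X_{[k,\ell]}\sim X_{[k,\ell]}X_{[j,k]}$ 13. $K_{[k,\ell]}X_{[j,k]}\sim X_{[j,k]}K_{[j,\ell]}$ 14. $K_{[j,\ell]}X_{[k,\ell]}\sim X_{[k,\ell]}K_{[j,k]}$ 15. $K_{[j,k]}i_{[k]}^2\sim X_{[j,k]}K_{[j,k]}$ 16. $K_{[j,k]}i_{[k]}^3\sim i_{[k]}K_{[j,k]}i_{[k]}K_{[j,k]}$ 17. $K_{[j,k]}i_{[j]}i_{[k]}\sim i_{[j]}i_{[k]}K_{[j,k]}$ 18. $K_{[j,k]}^2i_{[j]}i_{[k]}\sim\varepsilon$ 19. $K_{[j,k]}K_{[\ell,m]}K_{[j,\ell]}K_{[k,m]}\sim K_{[j,\ell]}K_{[k,m]}K_{[j,k]}K_{[\ell,m]}$ Let $\sim_{\mathcal R}$ be the smallest congruence (an equivalence relation compatible with concatenation) on $\mathcal G^*$ containing $\mathcal R$. Then $(\mathcal G,\mathcal R)$ is a monoid presentation of $U_n(\mathbb Z[\tfrac12,i])$: the set $\mathcal G$ generates $U_n(\mathbb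 Z[\tfrac12,i])$ as a monoid, and the relations are sound and complete, i.e. for all words $w,v\in\mathcal G^*$, $$w\sim_{\mathcal R}v\iff[\![w]\!]=[\![v]\!].$$ -/

import Mathlib

noncomputable section

namespace GaussianDyadic

/-- The ring `ℤ[1/2, i]`: the smallest subring of `ℂ` containing `1/2` and `i`. -/
def ringDI : Subring ℂ := Subring.closure {(1 / 2 : ℂ), Complex.I}

lemma half_mem : (1 / 2 : ℂ) ∈ ringDI := Subring.subset_closure (by simp)

lemma I_mem : Complex.I ∈ ringDI := Subring.subset_closure (by simp)

lemma star_mem_ringDI {z : ℂ} (hz : z ∈ ringDI) : star z ∈ ringDI := by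
  have h : ringDI ≤ ringDI.comap (starRingEnd ℂ) := by
    refine Subring.closure_le.2 ?_
    rintro x (rfl | rfl)
    · have e : starRingEnd ℂ (1 / 2) = 1 / 2 := by
        rw [map_div₀, map_one, map_ofNat]
      exact (congrArg (· ∈ ringDI) e).mpr half_mem
    · simpa using I_mem
  exact h hz

/-- `U_n(ℤ[1/2, i])`: the group of unitary `n × n` matrices with entries in `ℤ[1/2, i]`. -/
def unitaryDI (n : ℕ) : Subgroup (Matrix.unitaryGroup (Fin n) ℂ) where
  carrier := {U | ∀ a b, (U : Matrix (Fin n) (Fin n) ℂ) a b ∈ ringDI}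
  mul_mem' := by
    intro U V hU hV a b
    change ((U : Matrix (Fin n) (Fin n) ℂ) * (V : Matrix (Fin n) (Fin n) ℂ)) a b ∈ ringDI
    rw [Matrix.mul_apply]
    exact ringDI.sum_mem fun c _ => ringDI.mul_mem (hU a c) (hV c b)
  one_mem' := by
    intro a b
    change (1 : Matrix (Fin n) (Fin n) ℂ) a b ∈ ringDI
    rw [Matrix.one_apply]
    split_ifs
    · exact ringDI.one_mem
    · exact ringDI.zero_mem
  inv_mem' := by
    intro U hU a b
    exact star_mem_ringDI (hU b a)

/-- The one-level matrix `z_[j]`: the identity, except that the entry at `(j, j)` is `z`. -/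
def oneLevel {n : ℕ} (z : ℂ) (j : Fin n) : Matrix (Fin n) (Fin n) ℂ :=
  Matrix.of fun a b => if a = b then (if a = j then z else 1) else 0

/-- The two-level matrix `U_[j,k]` (used for `j < k`): the identity, except that its entries at
`(j, j)`, `(j, k)`, `(k, j)`, `(k, k)` are those of the `2 × 2` matrix `U`. -/
def twoLevel {n : ℕ} (U : Matrix (Fin 2) (Fin 2) ℂ) (j k : Fin n) :
    Matrix (Fin n) (Fin n) ℂ :=
  Matrix.of fun a b =>
    if a = j then (if b = j then U 0 0 else if b = k then U 0 1 else 0)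
    else if a = k then (if b = j then U 1 0 else if b = k then U 1 1 else 0)
    else if a = b then 1 else 0

/-- The matrix `X`. -/
def matX : Matrix (Fin 2) (Fin 2) ℂ := !![0, 1; 1, 0]

/-- The matrix `K = ω† H = (1 + i)⁻¹ [1, 1; 1, -1]`. -/
def matK : Matrix (Fin 2) (Fin 2) ℂ := (1 / (1 + Complex.I)) • !![1, 1; 1, -1]

lemma matX_mul_star : matX * star matX = 1 := by
  ext a b
  fin_cases a <;> fin_cases b <;> simp [matX, Matrix.mul_apply, Fin.sum_univ_two]

lemma inv_one_add_I : (1 + Complex.I)⁻¹ = (1 / 2) * (1 - Complex.I) := by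
  have h : (1 + Complex.I) * ((1 / 2) * (1 - Complex.I)) = 1 := by
    linear_combination (-1 / 2 : ℂ) * Complex.I_mul_I
  exact inv_eq_of_mul_eq_one_right h

lemma matK_mul_star : matK * star matK = 1 := by
  have h := Complex.I_mul_I
  ext a b
  fin_cases a <;> fin_cases b <;>
    simp [matK, Matrix.mul_apply, Fin.sum_univ_two, inv_one_add_I, map_ofNat (starRingEnd ℂ) 2] <;>
    ring_nf <;> simp [Complex.I_sq] <;> norm_num

lemma oneLevel_unitary {n : ℕ} {z : ℂ} (hz : z * star z = 1) (j : Fin n) :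
    oneLevel z j ∈ Matrix.unitaryGroup (Fin n) ℂ := by
  rw [Matrix.mem_unitaryGroup_iff]
  have : (oneLevel z j) = Matrix.diagonal (fun a => if a = j then z else 1) := by
    ext a b
    simp [oneLevel, Matrix.diagonal_apply]
  rw [this, Matrix.star_eq_conjTranspose, Matrix.diagonal_conjTranspose,
    Matrix.diagonal_mul_diagonal, ← Matrix.diagonal_one]
  congr 1
  ext a
  by_cases h : a = j
  · simpa [h] using hz
  · simp [h]

lemma twoLevel_unitary {n : ℕ} {U : Matrix (Fin 2) (Fin 2) ℂ} (hU : U * star U = 1)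
    {j k : Fin n} (h : j < k) : twoLevel U j k ∈ Matrix.unitaryGroup (Fin n) ℂ := by
  have hjk : j ≠ k := h.ne
  have h00 := congrFun (congrFun hU 0) 0
  have h01 := congrFun (congrFun hU 0) 1
  have h10 := congrFun (congrFun hU 1) 0
  have h11 := congrFun (congrFun hU 1) 1
  simp only [Matrix.mul_apply, Fin.sum_univ_two, Matrix.star_apply] at h00 h01 h10 h11
  rw [Matrix.mem_unitaryGroup_iff]
  -- a row of a two-level matrix acts on a function by at most two terms
  have key : ∀ (x y : ℂ) (f : Fin n → ℂ),
      ∑ c, (if c = j then x else if c = k then y else 0) * f c = x * f j + y * f k := by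
    intro x y f
    have : ∀ c, (if c = j then x else if c = k then y else 0) * f c
        = (if c = j then x * f c else 0) + (if c = k then y * f c else 0) := by
      intro c
      by_cases hc : c = j
      · subst hc
        simp [hjk]
      · simp [hc]
    simp [this, Finset.sum_add_distrib]
  ext a b
  rw [Matrix.mul_apply]
  by_cases ha : a = j
  · subst ha
    have e : ∀ c, twoLevel U a k a c = if c = a then U 0 0 else if c = k then U 0 1 else 0 := by
      intro c; simp [twoLevel]
    simp only [e, key]
    by_cases hb : b = a
    · subst hb
      simpa [twoLevel, hjk, hjk.symm] using h00
    · by_cases hb' : b = k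
      · subst hb'
        simpa [twoLevel, hjk, hjk.symm] using h01
      · simp [twoLevel, hb, hb', Ne.symm hb]
  · by_cases ha' : a = k
    · subst ha'
      have e : ∀ c, twoLevel U j a a c
          = if c = j then U 1 0 else if c = a then U 1 1 else 0 := by
        intro c; simp [twoLevel, ha]
      simp only [e, key]
      by_cases hb : b = j
      · subst hb
        simpa [twoLevel, hjk, hjk.symm] using h10
      · by_cases hb' : b = a
        · subst hb'
          simpa [twoLevel, hjk, hjk.symm] using h11
        · simp [twoLevel, hb, hb', Ne.symm hb']
    · have e : ∀ c, twoLevel U j k a c = if a = c then 1 else 0 := by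
        intro c; simp [twoLevel, ha, ha']
      simp only [e]
      by_cases hb : b = j
      · subst hb
        simp [twoLevel, ha, ha']
      · by_cases hb' : b = k
        · subst hb'
          simp [twoLevel, ha, ha', hb]
        · by_cases hab : b = a
          · subst hab
            simp [twoLevel, ha, ha']
          · simp [twoLevel, hb, hb', Ne.symm hab]

lemma twoLevel_mem {n : ℕ} {U : Matrix (Fin 2) (Fin 2) ℂ} (hU : ∀ s t, U s t ∈ ringDI)
    (j k a b : Fin n) : twoLevel U j k a b ∈ ringDI := by
  simp only [twoLevel, Matrix.of_apply]
  split_ifs <;> first | exact hU _ _ | exact ringDI.one_mem | exact ringDI.zero_mem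

lemma oneLevel_mem {n : ℕ} {z : ℂ} (hz : z ∈ ringDI) (j a b : Fin n) :
    oneLevel z j a b ∈ ringDI := by
  simp only [oneLevel, Matrix.of_apply]
  split_ifs <;> first | exact hz | exact ringDI.one_mem | exact ringDI.zero_mem

lemma matX_mem (s t : Fin 2) : matX s t ∈ ringDI := by
  fin_cases s <;> fin_cases t <;> simp [matX, ringDI.one_mem, ringDI.zero_mem]

lemma matK_mem (s t : Fin 2) : matK s t ∈ ringDI := by
  have h : (1 + Complex.I)⁻¹ ∈ ringDI := by
    rw [inv_one_add_I]
    exact ringDI.mul_mem half_mem (ringDI.sub_mem ringDI.one_mem I_mem)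
  have h' := ringDI.neg_mem h
  fin_cases s <;> fin_cases t <;> simpa [matK] using by assumption

/-- The generators: symbols for the matrices `X_[j,k]`, `K_[j,k]` (`j < k`) and `i_[j]`. -/
inductive Gen (n : ℕ) : Type
  | X (j k : Fin n) (h : j < k) : Gen n
  | K (j k : Fin n) (h : j < k) : Gen n
  | i (j : Fin n) : Gen n

/-- The element of `U_n(ℤ[1/2, i])` that a generator stands for. -/
def Gen.toUnitary {n : ℕ} : Gen n → unitaryDI n
  | .X j k h => ⟨⟨twoLevel matX j k, twoLevel_unitary matX_mul_star h⟩,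
      fun a b => twoLevel_mem matX_mem j k a b⟩
  | .K j k h => ⟨⟨twoLevel matK j k, twoLevel_unitary matK_mul_star h⟩,
      fun a b => twoLevel_mem matK_mem j k a b⟩
  | .i j => ⟨⟨oneLevel Complex.I j, oneLevel_unitary (by simp) j⟩,
      fun a b => oneLevel_mem I_mem j a b⟩

/-- The one-letter word `X_[j,k]`. -/
def wX {n : ℕ} (j k : Fin n) (h : j < k) : FreeMonoid (Gen n) := FreeMonoid.of (.X j k h)

/-- The one-letter word `K_[j,k]`. -/
def wK {n : ℕ} (j k : Fin n) (h : j < k) : FreeMonoid (Gen n) := FreeMonoid.of (.K j k h)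

/-- The one-letter word `i_[j]`. -/
def wi {n : ℕ} (j : Fin n) : FreeMonoid (Gen n) := FreeMonoid.of (.i j)

/-- The defining relations between words in the generators. In each relation the indices are
distinct, and `a < b` for each generator `X_[a,b]` or `K_[a,b]` that occurs in it. -/
inductive Rel (n : ℕ) : FreeMonoid (Gen n) → FreeMonoid (Gen n) → Prop
  | i_pow_four (j : Fin n) : Rel n (wi j ^ 4) 1
  | X_sq (j k : Fin n) (hjk : j < k) : Rel n (wX j k hjk ^ 2) 1
  | K_pow_eight (j k : Fin n) (hjk : j < k) : Rel n (wK j k hjk ^ 8) 1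
  | i_comm_i (j k : Fin n) (hjk : j ≠ k) : Rel n (wi j * wi k) (wi k * wi j)
  | i_comm_X (j k l : Fin n) (hjk : j ≠ k) (hjl : j ≠ l) (hkl : k < l) :
      Rel n (wi j * wX k l hkl) (wX k l hkl * wi j)
  | i_comm_K (j k l : Fin n) (hjk : j ≠ k) (hjl : j ≠ l) (hkl : k < l) :
      Rel n (wi j * wK k l hkl) (wK k l hkl * wi j)
  | X_comm_X (j k l m : Fin n) (hjk : j < k) (hlm : l < m)
      (hjl : j ≠ l) (hjm : j ≠ m) (hkl : k ≠ l) (hkm : k ≠ m) :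
      Rel n (wX j k hjk * wX l m hlm) (wX l m hlm * wX j k hjk)
  | X_comm_K (j k l m : Fin n) (hjk : j < k) (hlm : l < m)
      (hjl : j ≠ l) (hjm : j ≠ m) (hkl : k ≠ l) (hkm : k ≠ m) :
      Rel n (wX j k hjk * wK l m hlm) (wK l m hlm * wX j k hjk)
  | K_comm_K (j k l m : Fin n) (hjk : j < k) (hlm : l < m)
      (hjl : j ≠ l) (hjm : j ≠ m) (hkl : k ≠ l) (hkm : k ≠ m) :
      Rel n (wK j k hjk * wK l m hlm) (wK l m hlm * wK j k hjk)
  | i_swap (j k : Fin n) (hjk : j < k) :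
      Rel n (wi k * wX j k hjk) (wX j k hjk * wi j)
  | X_swap (j k l : Fin n) (hjk : j < k) (hkl : k < l) (hjl : j < l) :
      Rel n (wX k l hkl * wX j k hjk) (wX j k hjk * wX j l hjl)
  | X_swap' (j k l : Fin n) (hjk : j < k) (hkl : k < l) (hjl : j < l) :
      Rel n (wX j l hjl * wX k l hkl) (wX k l hkl * wX j k hjk)
  | K_swap (j k l : Fin n) (hjk : j < k) (hkl : k < l) (hjl : j < l) :
      Rel n (wK k l hkl * wX j k hjk) (wX j k hjk * wK j l hjl)
  | K_swap' (j k l : Fin n) (hjk : j < k) (hkl : k < l) (hjl : j < l) :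
      Rel n (wK j l hjl * wX k l hkl) (wX k l hkl * wK j k hjk)
  | K_i_sq (j k : Fin n) (hjk : j < k) :
      Rel n (wK j k hjk * wi k ^ 2) (wX j k hjk * wK j k hjk)
  | K_i_cube (j k : Fin n) (hjk : j < k) :
      Rel n (wK j k hjk * wi k ^ 3) (wi k * wK j k hjk * wi k * wK j k hjk)
  | K_i_i (j k : Fin n) (hjk : j < k) :
      Rel n (wK j k hjk * wi j * wi k) (wi j * wi k * wK j k hjk)
  | K_sq_i_i (j k : Fin n) (hjk : j < k) :
      Rel n (wK j k hjk ^ 2 * wi j * wi k) 1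
  | K_four (j k l m : Fin n) (hjk : j < k) (hlm : l < m) (hjl : j < l) (hkm : k < m)
      (hjm : j ≠ m) (hkl : k ≠ l) :
      Rel n (wK j k hjk * wK l m hlm * wK j l hjl * wK k m hkm)
        (wK j l hjl * wK k m hkm * wK j k hjk * wK l m hlm)

/-- `(X, R)` is a monoid presentation of `G`, where the alphabet `X` is regarded as a subset of `G`
through the injection `ι`: the alphabet generates `G` as a monoid, and the smallest congruence on
the words over `X` that contains `R` is sound and complete for equality in `G`. -/
structure IsMonoidPresentation {G X : Type*} [Monoid G] (ι : X → G)
    (R : FreeMonoid X → FreeMonoid X → Prop) : Prop where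
  injective : Function.Injective ι
  generates : Submonoid.closure (Set.range ι) = ⊤
  sound : ∀ w v : FreeMonoid X, conGen R w v → FreeMonoid.lift ι w = FreeMonoid.lift ι v
  complete : ∀ w v : FreeMonoid X, FreeMonoid.lift ι w = FreeMonoid.lift ι v → conGen R w v

end GaussianDyadic

end

noncomputable section

namespace GaussianDyadic

/-! ### Action of the generators on column vectors, injectivity of the alphabet, soundness of the
relations. -/

section


open Matrix

/-! The relations hold for the matrices (`lift_eq_of_rel`) and give every generator finite order, so
the presented monoid `Pres n` is a group with a homomorphism `toU` to the unitary group. The theorem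
amounts to bijectivity of `toU`, proved by induction on the dimension through the action on unit
vectors.

Surjectivity is a reduction algorithm. Write a unit vector as Gaussian integers over a power `gam ^
k` of `gam = 1 + i`, with `k` least. If `k` is positive, the number of numerators not divisible by
`gam` is even and positive. Two of them become congruent modulo `gam ^ 2` after a phase, and then a
`K` gate makes both divisible, which lowers `level`. If `k = 0`, the vector is a power of `i` times
a basis vector. So the group is transitive on unit vectors (`exists_act_eq`), and a unitary matrix
fixing the last basis vector is one of smaller size (`exists_lower`).

Injectivity needs the matching statement in the presented group: an element of `Pres (n + 1)` fixing
the last basis vector lies in the image of `Pres n` (`mem_range_emb`). For this one builds a map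
`sig` from unit vectors to the cosets of that image, sending the last basis vector to the trivial
coset, and shows that it is equivariant. It is defined by reduction: its value at `v` is `r⁻¹`
applied to its value at `r v`, for a chosen reducing step `r`.

Equivariance (`FixesLower.eqv`) is proved by induction on the level. First, the choice of `r` is
irrelevant (`EqvBelow.via_eq`): steps on disjoint pairs commute, changes of phase or order on one
pair are absorbed by generators already known to be compatible, and steps on overlapping pairs are
reconciled by `Rel.K_four`, using a fourth odd entry that parity provides. Then each generator is
compared with a suitable reducing step. The one delicate case, a `K` that keeps the level, is what
`Rel.K_i_cube` handles. -/

lemma twoLevel_mulVec {n : ℕ} (U : Matrix (Fin 2) (Fin 2) ℂ) {j k : Fin n} (h : j ≠ k)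
    (v : Fin n → ℂ) (a : Fin n) :
    (twoLevel U j k *ᵥ v) a = if a = j then U 0 0 * v j + U 0 1 * v k
      else if a = k then U 1 0 * v j + U 1 1 * v k else v a := by
  have key : ∀ x y : ℂ, ∑ c, (if c = j then x else if c = k then y else 0) * v c
      = x * v j + y * v k := by
    intro x y
    have : ∀ c, (if c = j then x else if c = k then y else 0) * v c
        = (if c = j then x * v c else 0) + (if c = k then y * v c else 0) := by
      intro c
      by_cases hc : c = j
      · subst hc
        simp [h]
      · simp [hc]
    simp [this, Finset.sum_add_distrib]
  simp only [mulVec, dotProduct, twoLevel, of_apply]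
  by_cases h1 : a = j
  · simp only [if_pos h1, key]
  · by_cases h2 : a = k
    · simp only [if_neg h1, if_pos h2, key]
    · simp [h1, h2]

lemma oneLevel_mulVec {n : ℕ} (z : ℂ) (j : Fin n) (v : Fin n → ℂ) (a : Fin n) :
    (oneLevel z j *ᵥ v) a = if a = j then z * v j else v a := by
  simp only [mulVec, dotProduct, oneLevel, of_apply]
  by_cases h : a = j
  · subst h; simp
  · simp [h]

/-- The action of `unitaryDI n` on column vectors. -/
def vecMap {n : ℕ} (U : unitaryDI n) (v : Fin n → ℂ) : Fin n → ℂ :=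
  (U.1 : Matrix (Fin n) (Fin n) ℂ) *ᵥ v

lemma vecMap_mul {n : ℕ} (U V : unitaryDI n) (v : Fin n → ℂ) :
    vecMap (U * V) v = vecMap U (vecMap V v) := by
  simp [vecMap, mulVec_mulVec]

lemma vecMap_one {n : ℕ} (v : Fin n → ℂ) : vecMap (1 : unitaryDI n) v = v := by
  simp [vecMap]

lemma vecMap_ext {n : ℕ} {U V : unitaryDI n} (h : ∀ v, vecMap U v = vecMap V v) : U = V := by
  apply Subtype.ext
  apply Subtype.ext
  exact Matrix.ext_of_mulVec_single fun j => h _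

lemma vecMap_i {n : ℕ} (j : Fin n) (v : Fin n → ℂ) (a : Fin n) :
    vecMap (Gen.i j).toUnitary v a = if a = j then Complex.I * v j else v a :=
  oneLevel_mulVec _ _ _ _

lemma vecMap_X {n : ℕ} (j k : Fin n) (h : j < k) (v : Fin n → ℂ) (a : Fin n) :
    vecMap (Gen.X j k h).toUnitary v a = if a = j then v k else if a = k then v j else v a := by
  refine (twoLevel_mulVec _ h.ne _ _).trans ?_
  simp [matX]

lemma vecMap_K {n : ℕ} (j k : Fin n) (h : j < k) (v : Fin n → ℂ) (a : Fin n) :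
    vecMap (Gen.K j k h).toUnitary v a = if a = j then (v j + v k) / (1 + Complex.I)
      else if a = k then (v j - v k) / (1 + Complex.I) else v a := by
  refine (twoLevel_mulVec _ h.ne _ _).trans ?_
  have e1 : (1 / (1 + Complex.I)) * v j + (1 / (1 + Complex.I)) * v k
    = (v j + v k) / (1 + Complex.I) := by ring
  have e2 : (1 / (1 + Complex.I)) * v j + -(1 / (1 + Complex.I)) * v k
    = (v j - v k) / (1 + Complex.I) := by ring
  rw [← e1, ← e2]
  simp [matK]

lemma one_add_I_ne : (1 + Complex.I) ≠ 0 := by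
  intro h
  have := congrArg Complex.re h
  simp at this

/-- The diagonal already identifies a generator: it differs from 1 by two zeros for `X`, by the two
distinct values `±1/(1+i)` for `K`, and by a single `i` for `i_[j]`. The condition `j < k` orders
the two zeros. -/
lemma toUnitary_injective {n : ℕ} :
    Function.Injective (Gen.toUnitary : Gen n → unitaryDI n) := by
  have hI1 : Complex.I ≠ 1 := fun h => by simpa using congrArg Complex.re h
  have hI0 := Complex.I_ne_zero
  have hc1 : (1 + Complex.I)⁻¹ ≠ 1 := by
    intro h; rw [inv_eq_one] at h; simp at h
  have hc2 : -(1 + Complex.I)⁻¹ ≠ 1 := by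
    intro h; rw [inv_one_add_I] at h; simpa using congrArg Complex.im h
  have hc3 : (1 + Complex.I)⁻¹ ≠ Complex.I := by
    intro h; rw [inv_one_add_I] at h; simpa using congrArg Complex.re h
  have hc4 : -(1 + Complex.I)⁻¹ ≠ (1 + Complex.I)⁻¹ := by
    intro h; rw [inv_one_add_I] at h
    have := congrArg Complex.re h
    norm_num at this
  have hc5 : (1 + Complex.I)⁻¹ ≠ 0 := inv_ne_zero one_add_I_ne
  have hc6 : -(1 + Complex.I)⁻¹ ≠ Complex.I := by
    intro h; rw [inv_one_add_I] at h; simpa using congrArg Complex.re h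
  intro g g' h
  have D : ∀ a, g.toUnitary.1.1 a a = g'.toUnitary.1.1 a a := fun a => by rw [h]
  cases g with
  | X j k hjk =>
    cases g' with
    | X j' k' hjk' =>
      have h1 := D j
      have h2 := D k
      have h3 := D j'
      simp only [Gen.toUnitary, twoLevel, of_apply, matX] at h1 h2 h3
      simp only [cons_val', cons_val_zero, cons_val_one, if_true, cons_val_fin_one] at h1 h2 h3
      grind
    | K j' k' hjk' =>
      have h1 := D j'
      simp only [Gen.toUnitary, twoLevel, of_apply, matX, matK] at h1
      simp at h1
      grind
    | i j' =>
      have h1 := D j'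
      simp only [Gen.toUnitary, twoLevel, oneLevel, of_apply, matX] at h1
      simp at h1
      grind
  | K j k hjk =>
    cases g' with
    | X j' k' hjk' =>
      have h1 := D j
      simp only [Gen.toUnitary, twoLevel, of_apply, matX, matK] at h1
      simp at h1
      grind
    | K j' k' hjk' =>
      have h1 := D j
      have h2 := D k
      simp only [Gen.toUnitary, twoLevel, of_apply, matK] at h1 h2
      simp at h1 h2
      grind
    | i j' =>
      have h1 := D j
      simp only [Gen.toUnitary, twoLevel, oneLevel, of_apply, matK] at h1
      simp at h1
      grind
  | i j =>
    cases g' with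
    | X j' k' hjk' =>
      have h1 := D j
      simp only [Gen.toUnitary, twoLevel, oneLevel, of_apply, matX] at h1
      simp at h1
      grind
    | K j' k' hjk' =>
      have h1 := D j'
      simp only [Gen.toUnitary, twoLevel, oneLevel, of_apply, matK] at h1
      simp at h1
      grind
    | i j' =>
      have h1 := D j
      simp only [Gen.toUnitary, oneLevel, of_apply] at h1
      simp at h1
      grind

/-- Acting on an arbitrary vector and reading off one coordinate turns each relation into an
identity in `i` and the inverse `c` of `1 + i`, with no matrix products. -/
lemma lift_eq_of_rel {n : ℕ} {w v : FreeMonoid (Gen n)} (h : Rel n w v) :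
    FreeMonoid.lift Gen.toUnitary w = FreeMonoid.lift Gen.toUnitary v := by
  have hI := Complex.I_sq
  have h0 := one_add_I_ne
  apply vecMap_ext
  intro u
  ext a
  have hc : (1 + Complex.I) * (1 + Complex.I)⁻¹ = 1 := mul_inv_cancel₀ h0
  set c := (1 + Complex.I)⁻¹ with hcd
  have hK : ∀ (j k : Fin n) (h : j < k) (v : Fin n → ℂ) (a : Fin n), vecMap (Gen.K j k h).toUnitary v a = if a = j then (v j + v k) * c
      else if a = k then (v j - v k) * c else v a := by
    intro j k h v a
    rw [vecMap_K, div_eq_mul_inv, div_eq_mul_inv]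
  -- `K` squares to the scalar `2/(1+i)^2 = -i` on its plane, so its eighth power is `(-i)^4`.
  have hK2 : ∀ (j k : Fin n) (h : j < k) (v : Fin n → ℂ),
      vecMap (Gen.K j k h).toUnitary (vecMap (Gen.K j k h).toUnitary v)
      = fun a => if a = j ∨ a = k then -Complex.I * v a else v a := by
    intro j k h v
    ext a
    simp only [hK]
    grind
  cases h <;>
  simp only [wX, wK, wi, pow_succ, pow_zero, one_mul, map_mul, map_one, FreeMonoid.lift_eval_of,
    vecMap_mul, vecMap_one, vecMap_i, vecMap_X, hK2]
  case K_pow_eight => grind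
  case K_four => simp only [hK]; grind
  all_goals try simp only [hK, vecMap_i, vecMap_X]
  all_goals grind

end

/-! ### The presented group, and its relations for indices in arbitrary order. -/

section


/-- The monoid presented by the generators and relations. -/
abbrev Pres (n : ℕ) : Type := (conGen (Rel n)).Quotient

/-- The class of a generator. -/
def cls {n : ℕ} (g : Gen n) : Pres n := (FreeMonoid.of g : FreeMonoid (Gen n))

lemma mk_eq_of_rel {n : ℕ} {w v : FreeMonoid (Gen n)} (h : Rel n w v) :
    (w : Pres n) = (v : Pres n) :=
  (Con.eq _).2 (ConGen.Rel.of _ _ h)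

/-- The finite-order relations supply the inverses. This makes the presented monoid a group, so that
cosets become available. -/
lemma cls_isUnit {n : ℕ} (g : Gen n) : IsUnit (cls g) := by
  cases g with
  | X j k h =>
    have e : cls (Gen.X j k h) ^ 2 = 1 := mk_eq_of_rel (Rel.X_sq j k h)
    exact IsUnit.of_pow_eq_one e (by norm_num)
  | K j k h =>
    have e : cls (Gen.K j k h) ^ 8 = 1 := mk_eq_of_rel (Rel.K_pow_eight j k h)
    exact IsUnit.of_pow_eq_one e (by norm_num)
  | i j =>
    have e : cls (Gen.i j) ^ 4 = 1 := mk_eq_of_rel (Rel.i_pow_four j)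
    exact IsUnit.of_pow_eq_one e (by norm_num)

lemma pres_induction {n : ℕ} {P : Pres n → Prop} (one : P 1)
    (mul : ∀ g m, P m → P (cls g * m)) (m : Pres n) : P m := by
  induction m using Con.induction_on with
  | H w =>
    induction w using FreeMonoid.inductionOn' with
    | one => exact one
    | of_mul g w ih => exact mul g _ ih

instance {n : ℕ} : Group (Pres n) :=
  groupOfIsUnit fun m => by
    induction m using pres_induction with
    | one => exact isUnit_one
    | mul g m ih => exact (cls_isUnit g).mul ih

variable {n : ℕ}

/-- The generator `i_[a]`. -/
def gI (a : Fin n) : Pres n := cls (.i a)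

/-- The swap of `a` and `b`, for all pairs of indices. -/
def gX (a b : Fin n) : Pres n :=
  if h : a < b then cls (.X a b h) else if h : b < a then cls (.X b a h) else 1

/-- The gate `K` on the ordered pair of indices `a`, `b`. -/
def gK (a b : Fin n) : Pres n :=
  if h : a < b then cls (.K a b h) else if h : b < a then gX a b * cls (.K b a h) * gX a b else 1

lemma gX_of_lt {a b : Fin n} (h : a < b) : gX a b = cls (.X a b h) := dif_pos h

lemma gK_of_lt {a b : Fin n} (h : a < b) : gK a b = cls (.K a b h) := dif_pos h

lemma gX_self (a : Fin n) : gX a a = 1 := by simp [gX]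

lemma gX_comm (a b : Fin n) : gX a b = gX b a := by
  rcases lt_trichotomy a b with h | rfl | h
  · simp [gX, h, h.not_gt]
  · rfl
  · simp [gX, h, h.not_gt]

lemma gX_mul_self (a b : Fin n) : gX a b * gX a b = 1 := by
  have key : ∀ a b : Fin n, a < b → gX a b * gX a b = 1 := by
    intro a b h
    rw [gX_of_lt h, ← pow_two]
    exact mk_eq_of_rel (Rel.X_sq a b h)
  rcases lt_trichotomy a b with h | rfl | h
  · exact key a b h
  · simp [gX_self]
  · rw [gX_comm]; exact key b a h

lemma gX_inv (a b : Fin n) : (gX a b)⁻¹ = gX a b := inv_eq_of_mul_eq_one_left (gX_mul_self a b)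

lemma gK_swap (a b : Fin n) : gK b a = gX a b * gK a b * gX a b := by
  rcases lt_trichotomy a b with h | rfl | h
  · simp [gK, h, h.not_gt, gX_comm b a]
  · simp [gK, gX_self]
  · rw [gK_of_lt h, gK, dif_neg h.not_gt, dif_pos h]
    simp only [← mul_assoc, gX_mul_self, one_mul]
    rw [mul_assoc, gX_mul_self, mul_one]

lemma semiconj_gX_gK_swap (a b : Fin n) : SemiconjBy (gX a b) (gK a b) (gK b a) := by
  rw [SemiconjBy, gK_swap a b, mul_assoc (gX a b * gK a b), gX_mul_self, mul_one]

lemma gI_pow_four (a : Fin n) : gI a ^ 4 = 1 := mk_eq_of_rel (Rel.i_pow_four a)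

lemma gI_commute (a b : Fin n) : Commute (gI a) (gI b) := by
  by_cases h : a = b
  · rw [h]
  · exact mk_eq_of_rel (Rel.i_comm_i a b h)

/-- Conjugation by an involution is symmetric. -/
lemma semiconj_gX_symm {a b : Fin n} {x y : Pres n} (h : SemiconjBy (gX a b) x y) :
    SemiconjBy (gX a b) y x := by
  have := h.inv_symm_left
  rwa [gX_inv] at this

lemma semiconj_gX_gI_left (a b : Fin n) : SemiconjBy (gX a b) (gI a) (gI b) := by
  have key : ∀ a b : Fin n, a < b → SemiconjBy (gX a b) (gI a) (gI b) := by
    intro a b h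
    rw [gX_of_lt h]
    exact (mk_eq_of_rel (Rel.i_swap a b h)).symm
  rcases lt_trichotomy a b with h | rfl | h
  · exact key a b h
  · rw [gX_self]; exact SemiconjBy.one_left _
  · rw [gX_comm]; exact semiconj_gX_symm (key b a h)

lemma commute_gI_gX {a b c : Fin n} (h1 : c ≠ a) (h2 : c ≠ b) : Commute (gI c) (gX a b) := by
  rcases lt_trichotomy a b with h | rfl | h
  · rw [gX_of_lt h]; exact mk_eq_of_rel (Rel.i_comm_X c a b h1 h2 h)
  · rw [gX_self]; exact Commute.one_right _
  · rw [gX_comm, gX_of_lt h]; exact mk_eq_of_rel (Rel.i_comm_X c b a h2 h1 h)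

lemma commute_gI_gK {a b c : Fin n} (h1 : c ≠ a) (h2 : c ≠ b) : Commute (gI c) (gK a b) := by
  have key : ∀ a b : Fin n, a < b → c ≠ a → c ≠ b → Commute (gI c) (gK a b) := by
    intro a b h h1 h2
    rw [gK_of_lt h]; exact mk_eq_of_rel (Rel.i_comm_K c a b h1 h2 h)
  rcases lt_trichotomy a b with h | rfl | h
  · exact key a b h h1 h2
  · simp [gK]
  · rw [gK_swap b a]
    exact ((commute_gI_gX h2 h1).mul_right (key b a h h2 h1)).mul_right (commute_gI_gX h2 h1)

lemma commute_gX_gX {a b c d : Fin n} (h1 : a ≠ c) (h2 : a ≠ d) (h3 : b ≠ c) (h4 : b ≠ d) :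
    Commute (gX a b) (gX c d) := by
  have key : ∀ a b c d : Fin n, a < b → c < d → a ≠ c → a ≠ d → b ≠ c → b ≠ d →
      Commute (gX a b) (gX c d) := by
    intro a b c d hab hcd h1 h2 h3 h4
    rw [gX_of_lt hab, gX_of_lt hcd]
    exact mk_eq_of_rel (Rel.X_comm_X a b c d hab hcd h1 h2 h3 h4)
  rcases lt_trichotomy a b with h | rfl | h
  · rcases lt_trichotomy c d with h' | rfl | h'
    · exact key a b c d h h' h1 h2 h3 h4
    · rw [gX_self c]; exact Commute.one_right _
    · rw [gX_comm c]; exact key a b d c h h' h2 h1 h4 h3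
  · rw [gX_self a]; exact Commute.one_left _
  · rw [gX_comm a]
    rcases lt_trichotomy c d with h' | rfl | h'
    · exact key b a c d h h' h3 h4 h1 h2
    · rw [gX_self c]; exact Commute.one_right _
    · rw [gX_comm c]; exact key b a d c h h' h4 h3 h2 h1

lemma commute_gX_gK {a b c d : Fin n} (h1 : a ≠ c) (h2 : a ≠ d) (h3 : b ≠ c) (h4 : b ≠ d) :
    Commute (gX a b) (gK c d) := by
  have key : ∀ a b c d : Fin n, a < b → c < d → a ≠ c → a ≠ d → b ≠ c → b ≠ d →
      Commute (gX a b) (gK c d) := by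
    intro a b c d hab hcd h1 h2 h3 h4
    rw [gX_of_lt hab, gK_of_lt hcd]
    exact mk_eq_of_rel (Rel.X_comm_K a b c d hab hcd h1 h2 h3 h4)
  have key2 : ∀ a b c d : Fin n, c < d → a ≠ c → a ≠ d → b ≠ c → b ≠ d →
      Commute (gX a b) (gK c d) := by
    intro a b c d hcd h1 h2 h3 h4
    rcases lt_trichotomy a b with h | rfl | h
    · exact key a b c d h hcd h1 h2 h3 h4
    · rw [gX_self a]; exact Commute.one_left _
    · rw [gX_comm a]; exact key b a c d h hcd h3 h4 h1 h2
  rcases lt_trichotomy c d with h | rfl | h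
  · exact key2 a b c d h h1 h2 h3 h4
  · simp [gK]
  · rw [gK_swap d c]
    have hx := commute_gX_gX h2 h1 h4 h3
    exact (hx.mul_right (key2 a b d c h h2 h1 h4 h3)).mul_right hx

lemma commute_gK_gK {a b c d : Fin n} (h1 : a ≠ c) (h2 : a ≠ d) (h3 : b ≠ c) (h4 : b ≠ d) :
    Commute (gK a b) (gK c d) := by
  have key : ∀ a b c d : Fin n, a < b → c < d → a ≠ c → a ≠ d → b ≠ c → b ≠ d →
      Commute (gK a b) (gK c d) := by
    intro a b c d hab hcd h1 h2 h3 h4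
    rw [gK_of_lt hab, gK_of_lt hcd]
    exact mk_eq_of_rel (Rel.K_comm_K a b c d hab hcd h1 h2 h3 h4)
  have key2 : ∀ a b c d : Fin n, c < d → a ≠ c → a ≠ d → b ≠ c → b ≠ d →
      Commute (gK a b) (gK c d) := by
    intro a b c d hcd h1 h2 h3 h4
    rcases lt_trichotomy a b with h | rfl | h
    · exact key a b c d h hcd h1 h2 h3 h4
    · simp [gK]
    · rw [gK_swap b a]
      have hx := commute_gX_gK h3 h4 h1 h2
      exact (hx.mul_left (key b a c d h hcd h3 h4 h1 h2)).mul_left hx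
  rcases lt_trichotomy c d with h | rfl | h
  · exact key2 a b c d h h1 h2 h3 h4
  · simp [gK]
  · rw [gK_swap d c]
    have hx := (commute_gX_gK h2.symm h4.symm h1.symm h3.symm).symm
    exact (hx.mul_right (key2 a b d c h h2 h1 h4 h3)).mul_right hx

/-- Swaps conjugate swaps. -/
lemma semiconj_gX_gX {a b c : Fin n} (hab : a ≠ b) (hac : a ≠ c) (hbc : b ≠ c) :
    SemiconjBy (gX a b) (gX a c) (gX b c) := by
  have key : ∀ j k l : Fin n, j < k → k < l →
      SemiconjBy (gX j k) (gX j l) (gX k l) ∧ SemiconjBy (gX k l) (gX j k) (gX j l) ∧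
      SemiconjBy (gX j l) (gX j k) (gX k l) := by
    intro j k l hjk hkl
    have hjl := hjk.trans hkl
    have e1 : gX k l * gX j k = gX j k * gX j l := by
      rw [gX_of_lt hjk, gX_of_lt hkl, gX_of_lt hjl]
      exact mk_eq_of_rel (Rel.X_swap j k l hjk hkl hjl)
    have e2 : gX j l * gX k l = gX k l * gX j k := by
      rw [gX_of_lt hjk, gX_of_lt hkl, gX_of_lt hjl]
      exact mk_eq_of_rel (Rel.X_swap' j k l hjk hkl hjl)
    exact ⟨e1.symm, e2.symm, semiconj_gX_symm (e2.trans e1)⟩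
  rcases hab.lt_or_gt with h1 | h1 <;> rcases hac.lt_or_gt with h2 | h2 <;>
    rcases hbc.lt_or_gt with h3 | h3
  · exact (key a b c h1 h3).1
  · rw [gX_comm b c]; exact (key a c b h2 h3).2.2
  · exact absurd (h1.trans h3) h2.not_gt
  · rw [gX_comm a c, gX_comm b c]; exact (key c a b h2 h1).2.1
  · rw [gX_comm a b]; exact semiconj_gX_symm (key b a c h1 h2).1
  · exact absurd (h1.trans h2) h3.not_gt
  · rw [gX_comm a b, gX_comm a c]; exact semiconj_gX_symm (key b c a h3 h2).2.2
  · rw [gX_comm a b, gX_comm a c, gX_comm b c]; exact semiconj_gX_symm (key c b a h3 h1).2.1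

/-- Swaps conjugate `K` gates. -/
lemma semiconj_gX_gK {a b c : Fin n} (hab : a ≠ b) (hac : a ≠ c) (hbc : b ≠ c) :
    SemiconjBy (gX a b) (gK a c) (gK b c) := by
  have flip : ∀ a b c : Fin n, a ≠ b → a ≠ c → b ≠ c → SemiconjBy (gX a b) (gK c a) (gK c b) →
      SemiconjBy (gX a b) (gK a c) (gK b c) := by
    intro a b c hab hac hbc h
    rw [gK_swap c a, gK_swap c b, gX_comm c a, gX_comm c b]
    have hx := semiconj_gX_gX hab hac hbc
    exact (hx.mul_right h).mul_right hx
  have key : ∀ j k l : Fin n, j < k → k < l →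
      SemiconjBy (gX j k) (gK j l) (gK k l) ∧ SemiconjBy (gX k l) (gK k j) (gK l j) ∧
      SemiconjBy (gX j l) (gK j k) (gK l k) := by
    intro j k l hjk hkl
    have hjl := hjk.trans hkl
    have e1 : gK k l * gX j k = gX j k * gK j l := by
      rw [gX_of_lt hjk, gK_of_lt hkl, gK_of_lt hjl]
      exact mk_eq_of_rel (Rel.K_swap j k l hjk hkl hjl)
    have e2 : gK j l * gX k l = gX k l * gK j k := by
      rw [gK_of_lt hjk, gX_of_lt hkl, gK_of_lt hjl]
      exact mk_eq_of_rel (Rel.K_swap' j k l hjk hkl hjl)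
    refine ⟨e1.symm, flip k l j hkl.ne hjk.ne' hjl.ne' e2.symm, ?_⟩
    -- The remaining conjugation is the composite of the two known ones with the flip of `K` on `k`,
    -- `l`.
    have e3 : gX j l = gX k l * gX j k * gX k l := by
      have := semiconj_gX_gX hkl.ne hjk.ne' hjl.ne'
      rw [gX_comm j l, gX_comm j k, this.eq, mul_assoc, gX_mul_self, mul_one]
    rw [e3]
    have e4 : SemiconjBy (gX j k) (gK j l) (gK k l) := e1.symm
    have e5 : SemiconjBy (gX k l) (gK j k) (gK j l) := e2.symm
    exact ((semiconj_gX_gK_swap k l).mul_left e4).mul_left e5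
  rcases hab.lt_or_gt with h1 | h1 <;> rcases hac.lt_or_gt with h2 | h2 <;>
    rcases hbc.lt_or_gt with h3 | h3
  · exact (key a b c h1 h3).1
  · exact (key a c b h2 h3).2.2
  · exact absurd (h1.trans h3) h2.not_gt
  · exact (key c a b h2 h1).2.1
  · rw [gX_comm a b]; exact semiconj_gX_symm (key b a c h1 h2).1
  · exact absurd (h1.trans h2) h3.not_gt
  · rw [gX_comm a b]; exact semiconj_gX_symm (key b c a h3 h2).2.2
  · rw [gX_comm a b]; exact semiconj_gX_symm (key c b a h3 h1).2.1

lemma semiconj_gX_gK' {a b c : Fin n} (hab : a ≠ b) (hac : a ≠ c) (hbc : b ≠ c) :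
    SemiconjBy (gX a b) (gK c a) (gK c b) := by
  rw [gK_swap a c, gK_swap b c]
  have hx := semiconj_gX_gX hab hac hbc
  exact (hx.mul_right (semiconj_gX_gK hab hac hbc)).mul_right hx

/-- Conjugating both sides of an equation. -/
lemma eq_of_semiconj {g x x' y y' : Pres n} (h : SemiconjBy g x x') (h' : SemiconjBy g y y')
    (e : x = y) : x' = y' := by
  have := h.eq.symm.trans ((congrArg (g * ·) e).trans h'.eq)
  exact mul_right_cancel this

lemma semiconj_gX_gI_right (a b : Fin n) : SemiconjBy (gX a b) (gI b) (gI a) :=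
  semiconj_gX_symm (semiconj_gX_gI_left a b)

lemma gK_mul_gI_sq {a b : Fin n} (hab : a ≠ b) : gK a b * gI b ^ 2 = gX a b * gK a b := by
  have key : ∀ a b : Fin n, a < b → gK a b * gI b ^ 2 = gX a b * gK a b := by
    intro a b h
    rw [gK_of_lt h, gX_of_lt h]
    exact mk_eq_of_rel (Rel.K_i_sq a b h)
  rcases hab.lt_or_gt with h | h
  · exact key a b h
  · have hK := semiconj_gX_gK_swap b a
    refine eq_of_semiconj (hK.mul_right ((semiconj_gX_gI_right b a).pow_right 2)) ?_ (key b a h)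
    rw [gX_comm a b]
    exact (Commute.refl (gX b a)).semiconjBy.mul_right hK

lemma gK_mul_gI_cube {a b : Fin n} (hab : a ≠ b) :
    gK a b * gI b ^ 3 = gI b * gK a b * gI b * gK a b := by
  have key : ∀ a b : Fin n, a < b → gK a b * gI b ^ 3 = gI b * gK a b * gI b * gK a b := by
    intro a b h
    rw [gK_of_lt h]
    exact mk_eq_of_rel (Rel.K_i_cube a b h)
  rcases hab.lt_or_gt with h | h
  · exact key a b h
  · have hK := semiconj_gX_gK_swap b a
    have hI := semiconj_gX_gI_right b a
    exact eq_of_semiconj (hK.mul_right (hI.pow_right 3))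
      (((hI.mul_right hK).mul_right hI).mul_right hK) (key b a h)

lemma commute_gK_gI_mul_gI {a b : Fin n} (hab : a ≠ b) : Commute (gK a b) (gI a * gI b) := by
  have key : ∀ a b : Fin n, a < b → gK a b * (gI a * gI b) = gI a * gI b * gK a b := by
    intro a b h
    rw [gK_of_lt h, ← mul_assoc]
    exact mk_eq_of_rel (Rel.K_i_i a b h)
  rcases hab.lt_or_gt with h | h
  · exact key a b h
  · have hK := semiconj_gX_gK_swap b a
    have hI := (semiconj_gX_gI_left b a).mul_right (semiconj_gX_gI_right b a)
    exact eq_of_semiconj (hK.mul_right hI) (hI.mul_right hK) (key b a h)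

lemma gK_sq_mul {a b : Fin n} (hab : a ≠ b) : gK a b * gK a b * (gI a * gI b) = 1 := by
  have key : ∀ a b : Fin n, a < b → gK a b * gK a b * (gI a * gI b) = 1 := by
    intro a b h
    rw [gK_of_lt h, ← mul_assoc, ← pow_two]
    exact mk_eq_of_rel (Rel.K_sq_i_i a b h)
  rcases hab.lt_or_gt with h | h
  · exact key a b h
  · have hK := semiconj_gX_gK_swap b a
    have hI := (semiconj_gX_gI_left b a).mul_right (semiconj_gX_gI_right b a)
    exact eq_of_semiconj ((hK.mul_right hK).mul_right hI) (SemiconjBy.one_right _) (key b a h)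

/-- A property of quadruples of distinct indices that is invariant under adjacent transpositions
and holds for increasing quadruples holds for all. -/
lemma forall_distinct_of_sorted {P : Fin n → Fin n → Fin n → Fin n → Prop}
    (h1 : ∀ a b c d, a ≠ b → a ≠ c → a ≠ d → b ≠ c → b ≠ d → c ≠ d → P a b c d → P b a c d)
    (h2 : ∀ a b c d, a ≠ b → a ≠ c → a ≠ d → b ≠ c → b ≠ d → c ≠ d → P a b c d → P a c b d)
    (h3 : ∀ a b c d, a ≠ b → a ≠ c → a ≠ d → b ≠ c → b ≠ d → c ≠ d → P a b c d → P a b d c)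
    (h0 : ∀ a b c d, a < b → b < c → c < d → P a b c d) {a b c d : Fin n}
    (hab : a ≠ b) (hac : a ≠ c) (had : a ≠ d) (hbc : b ≠ c) (hbd : b ≠ d) (hcd : c ≠ d) :
    P a b c d := by
  -- insert the first three indices in order, then the fourth
  have s1 : ∀ a b c d : Fin n, a < b → b < c → d ≠ a → d ≠ b → d ≠ c → P a b c d := by
    intro a b c d hab hbc hda hdb hdc
    grind
  have s2 : ∀ a b c d : Fin n, a < b → c ≠ a → c ≠ b → d ≠ a → d ≠ b → d ≠ c → P a b c d := by
    intro a b c d hab hca hcb hda hdb hdc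
    grind
  grind

/-- Conjugation by the swap of `a`, `b` or of `c`, `d` permutes the gates within this shape, and
exchanging `b` with `c` merely exchanges the two sides. These adjacent transpositions reach every
order of the four indices. -/
lemma gK_four {a b c d : Fin n}
    (hab : a ≠ b) (hac : a ≠ c) (had : a ≠ d) (hbc : b ≠ c) (hbd : b ≠ d) (hcd : c ≠ d) :
    gK a b * gK c d * gK a c * gK b d = gK a c * gK b d * gK a b * gK c d := by
  refine forall_distinct_of_sorted (P := fun a b c d =>
    gK a b * gK c d * gK a c * gK b d = gK a c * gK b d * gK a b * gK c d)
    ?_ ?_ ?_ ?_ hab hac had hbc hbd hcd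
  · intro a b c d hab hac had hbc hbd hcd e
    have x1 := semiconj_gX_gK_swap a b
    have x2 := (commute_gX_gK hac had hbc hbd).semiconjBy
    have x3 := semiconj_gX_gK hab hac hbc
    have x4 := semiconj_gX_symm (semiconj_gX_gK hab had hbd)
    exact eq_of_semiconj (((x1.mul_right x2).mul_right x3).mul_right x4)
      (((x3.mul_right x4).mul_right x1).mul_right x2) e
  · intro a b c d hab hac had hbc hbd hcd e
    exact e.symm
  · intro a b c d hab hac had hbc hbd hcd e
    have x1 := (commute_gX_gK hac.symm hbc.symm had.symm hbd.symm).semiconjBy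
    have x2 := semiconj_gX_gK_swap c d
    have x3 := semiconj_gX_gK' hcd hac.symm had.symm
    have x4 := semiconj_gX_symm (semiconj_gX_gK' hcd hbc.symm hbd.symm)
    exact eq_of_semiconj (((x1.mul_right x2).mul_right x3).mul_right x4)
      (((x3.mul_right x4).mul_right x1).mul_right x2) e
  · intro a b c d hab hbc hcd
    rw [gK_of_lt hab, gK_of_lt hcd, gK_of_lt (hab.trans hbc), gK_of_lt (hbc.trans hcd)]
    exact mk_eq_of_rel (Rel.K_four a b c d hab hcd (hab.trans hbc) (hbc.trans hcd)
      (hab.trans (hbc.trans hcd)).ne hbc.ne)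

end

/-! ### Gaussian integers modulo powers of `1 + i`. -/

section


open Complex

/-- The Gaussian integers as a subring of `ℂ`. -/
def zi : Subring ℂ := GaussianInt.toComplex.range

lemma mem_zi_iff {z : ℂ} : z ∈ zi ↔ ∃ x y : ℤ, z = x + y * I := by
  constructor
  · rintro ⟨w, rfl⟩
    exact ⟨w.re, w.im, GaussianInt.toComplex_def w⟩
  · rintro ⟨x, y, rfl⟩
    exact ⟨⟨x, y⟩, GaussianInt.toComplex_def' x y⟩

lemma I_mem_zi : I ∈ zi := mem_zi_iff.2 ⟨0, 1, by simp⟩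

/-- The prime above `2`. -/
def gam : ℂ := 1 + I

lemma gam_ne : gam ≠ 0 := one_add_I_ne

lemma gam_mem : gam ∈ zi := zi.add_mem zi.one_mem I_mem_zi

lemma gam_sq : gam ^ 2 = 2 * I := by
  rw [gam]; ring_nf; rw [I_sq]; ring

/-- Divisibility by `gam` in the Gaussian integers. -/
def Ev (z : ℂ) : Prop := ∃ t ∈ zi, z = gam * t

lemma Ev.mem {z : ℂ} (h : Ev z) : z ∈ zi := by
  obtain ⟨t, ht, rfl⟩ := h
  exact zi.mul_mem gam_mem ht

lemma Ev.add {x y : ℂ} (hx : Ev x) (hy : Ev y) : Ev (x + y) := by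
  obtain ⟨s, hs, rfl⟩ := hx
  obtain ⟨t, ht, rfl⟩ := hy
  exact ⟨s + t, zi.add_mem hs ht, by ring⟩

lemma Ev.mul {x y : ℂ} (hx : x ∈ zi) (hy : Ev y) : Ev (x * y) := by
  obtain ⟨t, ht, rfl⟩ := hy
  exact ⟨x * t, zi.mul_mem hx ht, by ring⟩

lemma Ev.neg {x : ℂ} (hx : Ev x) : Ev (-x) := by
  simpa using Ev.mul (zi.neg_mem zi.one_mem) hx

lemma Ev.sub {x y : ℂ} (hx : Ev x) (hy : Ev y) : Ev (x - y) := by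
  rw [sub_eq_add_neg]; exact hx.add hy.neg

/-- As 2 is an associate of `gam ^ 2`, signs are invisible modulo `gam ^ 2`. -/
lemma two_eq : (2 : ℂ) = gam ^ 2 * (-I) := by
  rw [gam_sq]; ring_nf; rw [I_sq]; ring

/-- The residue field has two elements, and `x ^ 2 + y ^ 2` has the parity of `x + y`. The norm is
carried along because the unit-vector condition is a statement about norms. -/
lemma ev_or (z : ℂ) (hz : z ∈ zi) :
    (Ev z ∧ ∃ N : ℕ, normSq z = N ∧ Even N) ∨ (Ev (z - 1) ∧ ∃ N : ℕ, normSq z = N ∧ Odd N) := by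
  obtain ⟨x, y, rfl⟩ := mem_zi_iff.1 hz
  have hN : normSq (x + y * I) = ((x ^ 2 + y ^ 2).toNat : ℕ) := by
    have : ((x ^ 2 + y ^ 2).toNat : ℤ) = x ^ 2 + y ^ 2 := Int.toNat_of_nonneg (by positivity)
    have h2 : (((x ^ 2 + y ^ 2).toNat : ℤ) : ℝ) = x ^ 2 + y ^ 2 := by rw [this]; push_cast; ring
    rw [Int.cast_natCast] at h2
    rw [h2, normSq_apply]; simp; ring
  have hcast : ((x ^ 2 + y ^ 2).toNat : ℤ) = x ^ 2 + y ^ 2 := Int.toNat_of_nonneg (by positivity)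
  rcases Int.even_or_odd' (x + y) with ⟨m, hm | hm⟩
  · left
    -- The quotient by `1 + i` is `((x + y) + (y - x) i) / 2`, with `x + y = 2 m`.
    refine ⟨⟨m + (m - x : ℤ) * I, mem_zi_iff.2 ⟨m, m - x, rfl⟩, ?_⟩, _, hN, ?_⟩
    · have : (y : ℂ) = 2 * m - x := by
        have : y = 2 * m - x := by linarith
        rw [this]; push_cast; ring
      rw [this, gam]; push_cast
      linear_combination (-(m:ℂ) + x) * I_sq
    · rw [← Int.even_coe_nat, hcast]
      have : y = 2 * m - x := by linarith
      exact ⟨x ^ 2 + 2 * m ^ 2 - 2 * m * x, by rw [this]; ring⟩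
  · right
    refine ⟨⟨m + (m - x + 1 : ℤ) * I, mem_zi_iff.2 ⟨m, m - x + 1, rfl⟩, ?_⟩, _, hN, ?_⟩
    · have : (y : ℂ) = 2 * m + 1 - x := by
        have : y = 2 * m + 1 - x := by linarith
        rw [this]; push_cast; ring
      rw [this, gam]; push_cast
      linear_combination (-(m:ℂ) + x - 1) * I_sq
    · rw [← Int.odd_coe_nat, hcast]
      have : y = 2 * m + 1 - x := by linarith
      exact ⟨x ^ 2 + 2 * m ^ 2 - 2 * m * x + 2 * m - x, by rw [this]; ring⟩

lemma not_ev_one : ¬ Ev 1 := by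
  rintro ⟨t, ht, h⟩
  obtain ⟨N, hN⟩ : ∃ N : ℕ, normSq t = N := by
    rcases ev_or t ht with ⟨_, N, h, _⟩ | ⟨_, N, h, _⟩ <;> exact ⟨N, h⟩
  have h2 : (1 : ℝ) = 2 * N := by
    have := congrArg normSq h
    rw [normSq_mul, normSq_one, hN] at this
    rw [this]; simp [gam, normSq_apply]; norm_num
  have h3 : 1 = 2 * N := by exact_mod_cast h2
  omega

lemma ev_sub_one_of_not {z : ℂ} (hz : z ∈ zi) (h : ¬ Ev z) : Ev (z - 1) := by
  rcases ev_or z hz with h' | h'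
  · exact absurd h'.1 h
  · exact h'.1

lemma odd_normSq_iff {z : ℂ} (hz : z ∈ zi) : ∃ N : ℕ, normSq z = N ∧ (Odd N ↔ ¬ Ev z) := by
  rcases ev_or z hz with ⟨h, N, hN, e⟩ | ⟨h, N, hN, e⟩
  · exact ⟨N, hN, by simp [h, e]⟩
  · refine ⟨N, hN, ?_⟩
    have : ¬ Ev z := fun h' => not_ev_one (by simpa using h'.sub h)
    simp [this, e]

lemma ev_sub_of_not {x y : ℂ} (hx : x ∈ zi) (hy : y ∈ zi) (h : ¬ Ev x) (h' : ¬ Ev y) :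
    Ev (x - y) := by
  simpa using (ev_sub_one_of_not hx h).sub (ev_sub_one_of_not hy h')

lemma ev_I_mul {x : ℂ} : Ev (I * x) ↔ Ev x := by
  refine ⟨fun h => ?_, fun h => Ev.mul I_mem_zi h⟩
  convert Ev.mul (zi.neg_mem I_mem_zi) h using 1
  linear_combination x * I_sq

lemma I_mul_mem {x : ℂ} : I * x ∈ zi ↔ x ∈ zi := by
  refine ⟨fun h => ?_, fun h => zi.mul_mem I_mem_zi h⟩
  convert zi.mul_mem (zi.neg_mem I_mem_zi) h using 1
  linear_combination x * I_sq

lemma ev_I_pow_mul {x : ℂ} (q : ℕ) : Ev (I ^ q * x) ↔ Ev x := by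
  induction q with
  | zero => simp
  | succ q ih => rw [pow_succ', mul_assoc, ev_I_mul, ih]

lemma I_pow_mul_mem {x : ℂ} (q : ℕ) : I ^ q * x ∈ zi ↔ x ∈ zi := by
  induction q with
  | zero => simp
  | succ q ih => rw [pow_succ', mul_assoc, I_mul_mem, ih]

/-- Congruence modulo `gam ^ k`. -/
def Cg (k : ℕ) (x y : ℂ) : Prop := ∃ t ∈ zi, x - y = gam ^ k * t

lemma Cg.mono {k : ℕ} {x y : ℂ} (h : Cg (k + 1) x y) : Cg k x y := by
  obtain ⟨t, ht, e⟩ := h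
  exact ⟨gam * t, zi.mul_mem gam_mem ht, by rw [e]; ring⟩

/-- The units modulo `gam ^ 2` are the classes of 1 and `i`: if `x - y = gam * t` with `t` odd, then
`x - i y = gam * (t - i y)` and the bracket is even. -/
lemma exists_phase_two {x y : ℂ} (hx : x ∈ zi) (hy : y ∈ zi) (h : ¬ Ev x) (h' : ¬ Ev y) :
    Cg 2 x y ∨ Cg 2 x (I * y) := by
  obtain ⟨t, ht, e⟩ := ev_sub_of_not hx hy h h'
  by_cases h1 : Ev t
  · obtain ⟨s, hs, rfl⟩ := h1
    exact Or.inl ⟨s, hs, by rw [e]; ring⟩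
  · obtain ⟨s, hs, e2⟩ := ev_sub_of_not ht (I_mul_mem.2 hy) h1 (by rwa [ev_I_mul])
    refine Or.inr ⟨s, hs, ?_⟩
    rw [gam] at *
    linear_combination e + (1 + I) * e2 + y * I_sq

/-- The four powers of `i` exhaust the units modulo `gam ^ 3`: once `x` and `y` agree modulo `gam ^
2`, passing to `-y` corrects the next digit. -/
lemma exists_phase_three {x y : ℂ} (hx : x ∈ zi) (hy : y ∈ zi) (h : ¬ Ev x) (h' : ¬ Ev y) :
    ∃ q : ℕ, Cg 3 x (I ^ q * y) := by
  have key : ∀ y ∈ zi, ¬ Ev y → Cg 2 x y → ∃ q : ℕ, Cg 3 x (I ^ q * y) := by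
    rintro y hy h' ⟨t, ht, e⟩
    by_cases h1 : Ev t
    · obtain ⟨s, hs, rfl⟩ := h1
      exact ⟨0, s, hs, by rw [pow_zero, one_mul, e]; ring⟩
    · obtain ⟨s, hs, e2⟩ := ev_sub_of_not ht (I_mul_mem.2 hy) h1 (by rwa [ev_I_mul])
      refine ⟨2, s, hs, ?_⟩
      have := two_eq
      linear_combination e + gam ^ 2 * e2 - y * I_sq + y * this
  rcases exists_phase_two hx hy h h' with h1 | h1
  · exact key y hy h' h1
  · obtain ⟨q, hq⟩ := key _ (I_mul_mem.2 hy) (by rwa [ev_I_mul]) h1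
    exact ⟨q + 1, by rwa [pow_succ, mul_assoc]⟩

lemma exists_pow_mul_mem {z : ℂ} (hz : z ∈ ringDI) : ∃ k : ℕ, gam ^ k * z ∈ zi := by
  have up : ∀ {z : ℂ} {k : ℕ} (m : ℕ), gam ^ k * z ∈ zi → gam ^ (k + m) * z ∈ zi := by
    intro z k m h
    rw [pow_add, mul_right_comm, mul_comm]
    exact zi.mul_mem (zi.pow_mem gam_mem m) h
  induction hz using Subring.closure_induction with
  | mem x hx =>
    rcases hx with rfl | rfl
    · exact ⟨2, by convert I_mem_zi using 1; rw [gam_sq]; ring⟩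
    · exact ⟨0, by simpa using I_mem_zi⟩
  | zero => exact ⟨0, by simp⟩
  | one => exact ⟨0, by simp⟩
  | add x y _ _ hx hy =>
    obtain ⟨k, hk⟩ := hx
    obtain ⟨l, hl⟩ := hy
    refine ⟨k + l, ?_⟩
    rw [mul_add]
    exact zi.add_mem (up l hk) (add_comm l k ▸ up k hl)
  | neg x _ hx =>
    obtain ⟨k, hk⟩ := hx
    exact ⟨k, by rw [mul_neg]; exact zi.neg_mem hk⟩
  | mul x y _ _ hx hy =>
    obtain ⟨k, hk⟩ := hx
    obtain ⟨l, hl⟩ := hy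
    refine ⟨k + l, ?_⟩
    convert zi.mul_mem hk hl using 1
    ring

lemma eq_I_pow_of_normSq {z : ℂ} (hz : z ∈ zi) (h : normSq z = 1) : ∃ p : ℕ, z = I ^ p := by
  obtain ⟨x, y, rfl⟩ := mem_zi_iff.1 hz
  have e : x ^ 2 + y ^ 2 = 1 := by
    have : (x : ℝ) ^ 2 + y ^ 2 = 1 := by
      rw [← h, normSq_apply]; simp; ring
    exact_mod_cast this
  have hx : x ≤ 1 ∧ -1 ≤ x := by constructor <;> nlinarith [sq_nonneg y]
  have hy : y ≤ 1 ∧ -1 ≤ y := by constructor <;> nlinarith [sq_nonneg x]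
  obtain ⟨hx1, hx2⟩ := hx
  obtain ⟨hy1, hy2⟩ := hy
  interval_cases x <;> interval_cases y <;> simp at e
  · exact ⟨2, by simp⟩
  · exact ⟨3, by simp⟩
  · exact ⟨1, by simp⟩
  · exact ⟨0, by simp⟩

/-! ### Denominator exponents, the level, and unit vectors. -/

variable {n : ℕ}

/-- `gam ^ k` clears the denominators of `v`. -/
def Adm (k : ℕ) (v : Fin n → ℂ) : Prop := ∀ j, gam ^ k * v j ∈ zi

open Classical in
/-- The positions of the odd entries of `gam ^ k • v`. -/
def oddSet (k : ℕ) (v : Fin n → ℂ) : Finset (Fin n) := {j | ¬ Ev (gam ^ k * v j)}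

lemma mem_oddSet {k : ℕ} {v : Fin n → ℂ} {j : Fin n} : j ∈ oddSet k v ↔ ¬ Ev (gam ^ k * v j) := by
  simp [oddSet]

/-- `k` is the least denominator exponent of `v`. -/
def IsLde (k : ℕ) (v : Fin n → ℂ) : Prop := Adm k v ∧ (k = 0 ∨ (oddSet k v).Nonempty)

lemma Adm.mono {k l : ℕ} {v : Fin n → ℂ} (h : Adm k v) (hkl : k ≤ l) : Adm l v := by
  obtain ⟨m, rfl⟩ := Nat.exists_eq_add_of_le hkl
  intro j
  rw [pow_add, mul_right_comm, mul_comm]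
  exact zi.mul_mem (zi.pow_mem gam_mem m) (h j)

lemma Adm.ev_of_lt {k l : ℕ} {v : Fin n → ℂ} (h : Adm k v) (hkl : k < l) (j : Fin n) :
    Ev (gam ^ l * v j) := by
  obtain ⟨m, rfl⟩ := Nat.exists_eq_add_of_lt hkl
  exact ⟨_, h.mono (Nat.le_add_right k m) j, by ring⟩

lemma Adm.exists_isLde {k : ℕ} {v : Fin n → ℂ} (h : Adm k v) : ∃ l ≤ k, IsLde l v := by
  induction k with
  | zero => exact ⟨0, le_rfl, h, Or.inl rfl⟩
  | succ k ih =>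
    by_cases hS : (oddSet (k + 1) v).Nonempty
    · exact ⟨k + 1, le_rfl, h, Or.inr hS⟩
    · obtain ⟨l, hl, h'⟩ := ih fun j => by
        have : Ev (gam ^ (k + 1) * v j) := by
          by_contra hj
          exact hS ⟨j, mem_oddSet.2 hj⟩
        obtain ⟨t, ht, e⟩ := this
        rw [pow_succ', mul_assoc] at e
        rwa [mul_left_cancel₀ gam_ne e]
      exact ⟨l, hl.trans k.le_succ, h'⟩

lemma IsLde.le {k l : ℕ} {v : Fin n → ℂ} (h : IsLde k v) (h' : Adm l v) : k ≤ l := by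
  by_contra hlt
  rcases h.2 with rfl | ⟨j, hj⟩
  · omega
  · exact mem_oddSet.1 hj (h'.ev_of_lt (not_le.1 hlt) j)

open Classical in
/-- A measure for the complexity of `v`: the least denominator exponent, then the number of entries
that attain it. -/
def level (v : Fin n → ℂ) : ℕ :=
  -- The factor `n + 1` exceeds every cardinality that can occur, so this number orders the pairs
  -- lexicographically. The value 0 is a default for vectors without an exponent.
  if h : ∃ k, IsLde k v then h.choose * (n + 1) + (oddSet h.choose v).card else 0

lemma IsLde.level_eq {k : ℕ} {v : Fin n → ℂ} (h : IsLde k v) :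
    level v = k * (n + 1) + (oddSet k v).card := by
  have hex : ∃ k, IsLde k v := ⟨k, h⟩
  have : hex.choose = k := le_antisymm (hex.choose_spec.le h.1) (h.le hex.choose_spec.1)
  rw [level, dif_pos hex, this]

lemma card_oddSet_le (k : ℕ) (v : Fin n → ℂ) : (oddSet k v).card ≤ n := by
  simpa using Finset.card_le_univ (oddSet k v)

/-- The exponent of `v'` need not be least: if the least one is smaller than `k`, it decides the
comparison, and otherwise the cardinalities do. -/
lemma level_lt {k : ℕ} {v v' : Fin n → ℂ} (h : IsLde k v) (h' : Adm k v')
    (hc : (oddSet k v').card < (oddSet k v).card) : level v' < level v := by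
  obtain ⟨l, hl, hl'⟩ := h'.exists_isLde
  rw [h.level_eq, hl'.level_eq]
  rcases hl.eq_or_lt with rfl | hlt
  · omega
  · have := card_oddSet_le l v'
    have : (l + 1) * (n + 1) ≤ k * (n + 1) := Nat.mul_le_mul_right _ hlt
    rw [add_mul] at this
    omega

/-- A vector of level at most that of `v` has no larger denominators than `v`. -/
lemma isLde_of_level_le {k l : ℕ} {v v' : Fin n → ℂ} (h : IsLde k v) (h' : IsLde l v')
    (hle : level v' ≤ level v) : l ≤ k := by
  rw [h.level_eq, h'.level_eq] at hle
  by_contra hlt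
  have := card_oddSet_le k v
  have : (k + 1) * (n + 1) ≤ l * (n + 1) := Nat.mul_le_mul_right _ (not_le.1 hlt)
  rw [add_mul] at this
  omega

/-- The unit vectors with entries in `ℤ[1/2, i]`. -/
def IsUnitVec (v : Fin n → ℂ) : Prop := (∀ j, v j ∈ ringDI) ∧ ∑ j, normSq (v j) = 1

lemma IsUnitVec.exists_isLde {v : Fin n → ℂ} (h : IsUnitVec v) : ∃ k, IsLde k v := by
  choose k hk using fun j => exists_pow_mul_mem (h.1 j)
  have : Adm (∑ j, k j) v := fun j => by
    have hle : k j ≤ ∑ j, k j := Finset.single_le_sum (fun _ _ => Nat.zero_le _) (Finset.mem_univ j)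
    obtain ⟨m, hm⟩ := Nat.exists_eq_add_of_le hle
    rw [hm, pow_add, mul_right_comm, mul_comm]
    exact zi.mul_mem (zi.pow_mem gam_mem m) (hk j)
  obtain ⟨l, _, hl⟩ := this.exists_isLde
  exact ⟨l, hl⟩

/-- The norms of the numerators sum to `2 ^ k`, which is even, and the odd norms are those of the
odd entries. This parity supplies a second odd entry to reduce with, and a fourth one once there are
three. -/
lemma IsUnitVec.even_card {v : Fin n → ℂ} (h : IsUnitVec v) {k : ℕ} (hk : 1 ≤ k) (hv : Adm k v) :
    Even (oddSet k v).card := by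
  classical
  choose N hN hodd using fun j => odd_normSq_iff (hv j)
  have hsum : ∑ j, N j = 2 ^ k := by
    have : ((∑ j, N j : ℕ) : ℝ) = 2 ^ k := by
      push_cast
      simp_rw [← hN, normSq_mul, ← Finset.mul_sum, h.2, map_pow, mul_one]
      congr 1
      simp [gam, normSq_apply]; norm_num
    exact_mod_cast this
  have h1 := Finset.odd_sum_iff_odd_card_odd (s := Finset.univ) N
  have h2 : (Finset.univ.filter fun j => Odd (N j)) = oddSet k v := by
    ext j; simp [mem_oddSet, hodd]
  rw [h2, hsum] at h1
  rw [← Nat.not_odd_iff_even, ← h1, Nat.not_odd_iff_even]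
  exact (Nat.even_pow.2 ⟨even_two, by omega⟩)

/-- Nonnegative integers with sum 1 are all zero except for a single 1, and a Gaussian integer of
norm 1 is a power of `i`. -/
lemma IsUnitVec.eq_single {v : Fin n → ℂ} (h : IsUnitVec v) (hv : Adm 0 v) :
    ∃ (c : Fin n) (p : ℕ), v = Pi.single c (I ^ p) := by
  have hv' : ∀ j, v j ∈ zi := fun j => by simpa using hv j
  choose N hN _ using fun j => odd_normSq_iff (hv' j)
  have hsum : ∑ j, N j = 1 := by
    have : ((∑ j, N j : ℕ) : ℝ) = 1 := by
      push_cast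
      simp_rw [← hN, h.2]
    exact_mod_cast this
  obtain ⟨c, -, hc⟩ : ∃ c ∈ Finset.univ, N c ≠ 0 := by
    apply Finset.exists_ne_zero_of_sum_ne_zero
    rw [hsum]; norm_num
  have hsplit := Finset.add_sum_erase Finset.univ N (Finset.mem_univ c)
  have hc1 : N c = 1 := by omega
  have hz : ∑ j ∈ Finset.univ.erase c, N j = 0 := by omega
  obtain ⟨p, hp⟩ := eq_I_pow_of_normSq (hv' c) (by rw [hN, hc1]; simp)
  refine ⟨c, p, ?_⟩
  ext j
  by_cases hj : j = c
  · subst hj; simp [hp]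
  · rw [Pi.single_eq_of_ne hj, ← normSq_eq_zero, hN]
    simpa using (Finset.sum_eq_zero_iff.1 hz) j (by simp [hj])

/-! ### The presented group acting on unit vectors. -/

/-- The homomorphism from the presented group to the unitary group. -/
def toU : Pres n →* unitaryDI n :=
  (conGen (Rel n)).lift (FreeMonoid.lift Gen.toUnitary) (Con.conGen_le.2 fun _ _ h =>
    lift_eq_of_rel h)

lemma toU_coe (w : FreeMonoid (Gen n)) : toU (w : Pres n) = FreeMonoid.lift Gen.toUnitary w := rfl

lemma toU_cls (g : Gen n) : toU (cls g) = g.toUnitary := by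
  rw [cls, toU_coe, FreeMonoid.lift_eval_of]

/-- The action of the presented group on column vectors. -/
def act (g : Pres n) (v : Fin n → ℂ) : Fin n → ℂ := vecMap (toU g) v

lemma act_mul (g h : Pres n) (v : Fin n → ℂ) : act (g * h) v = act g (act h v) := by
  simp [act, vecMap_mul]

lemma act_one (v : Fin n → ℂ) : act (1 : Pres n) v = v := by simp [act, vecMap_one]

lemma act_gI (a : Fin n) (v : Fin n → ℂ) (c : Fin n) :
    act (gI a) v c = if c = a then I * v a else v c := by
  rw [act, gI, toU_cls, vecMap_i]

lemma act_gI_pow (a : Fin n) (q : ℕ) (v : Fin n → ℂ) (c : Fin n) :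
    act (gI a ^ q) v c = if c = a then I ^ q * v a else v c := by
  induction q with
  | zero => simp [act_one]; rintro rfl; rfl
  | succ q ih =>
    rw [pow_succ', act_mul, act_gI]
    split_ifs with h
    · subst h
      simp only [if_true] at ih
      rw [ih]; ring
    · rw [ih, if_neg h]

lemma act_gX (a b : Fin n) (v : Fin n → ℂ) (c : Fin n) :
    act (gX a b) v c = v (Equiv.swap a b c) := by
  have key : ∀ a b : Fin n, a < b → act (gX a b) v c = v (Equiv.swap a b c) := by
    intro a b h
    rw [act, gX_of_lt h, toU_cls, vecMap_X, Equiv.swap_apply_def]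
    split_ifs <;> rfl
  rcases lt_trichotomy a b with h | rfl | h
  · exact key a b h
  · simp [gX_self, act_one]
  · rw [gX_comm, Equiv.swap_comm]; exact key b a h

lemma act_gK {a b : Fin n} (hab : a ≠ b) (v : Fin n → ℂ) (c : Fin n) :
    act (gK a b) v c = if c = a then (v a + v b) / gam else if c = b then (v a - v b) / gam
      else v c := by
  have key : ∀ a b : Fin n, a < b → ∀ v : Fin n → ℂ, ∀ c, act (gK a b) v c =
      if c = a then (v a + v b) / gam else if c = b then (v a - v b) / gam else v c := by
    intro a b h v c
    rw [act, gK_of_lt h, toU_cls, vecMap_K, gam]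
  rcases hab.lt_or_gt with h | h
  · exact key a b h v c
  · rw [gK_swap b a, act_mul, act_mul, act_gX, key b a h]
    simp only [act_gX]
    by_cases h1 : c = a
    · subst h1; simp [add_comm]
    · by_cases h2 : c = b
      · subst h2; simp [hab, hab.symm]
      · simp [h1, h2, Equiv.swap_apply_of_ne_of_ne]

lemma IsUnitVec.vecMap {v : Fin n → ℂ} (h : IsUnitVec v) (U : unitaryDI n) :
    IsUnitVec (vecMap U v) := by
  refine ⟨fun j => ?_, ?_⟩
  · change ∑ c, U.1.1 j c * v c ∈ ringDI
    exact ringDI.sum_mem fun c _ => ringDI.mul_mem (U.2 j c) (h.1 c)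
  have key : ∀ w : Fin n → ℂ, ((∑ j, normSq (w j) : ℝ) : ℂ) = star w ⬝ᵥ w := by
    intro w
    simp [dotProduct, normSq_eq_conj_mul_self]
  have : ((∑ j, normSq (GaussianDyadic.vecMap U v j) : ℝ) : ℂ) = ((∑ j, normSq (v j) : ℝ) : ℂ) := by
    rw [key, key, GaussianDyadic.vecMap, Matrix.star_mulVec, Matrix.dotProduct_mulVec,
      Matrix.vecMul_vecMul, ← Matrix.star_eq_conjTranspose,
      Matrix.mem_unitaryGroup_iff'.1 U.1.2, Matrix.vecMul_one]
  rw [ofReal_inj] at this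
  rw [this, h.2]

lemma IsUnitVec.act {v : Fin n → ℂ} (h : IsUnitVec v) (g : Pres n) : IsUnitVec (act g v) :=
  h.vecMap _

lemma isUnitVec_single (c : Fin n) : IsUnitVec (Pi.single c 1 : Fin n → ℂ) := by
  constructor
  · intro j
    by_cases h : j = c
    · subst h; simp
    · rw [Pi.single_eq_of_ne h]; exact ringDI.zero_mem
  · rw [Finset.sum_eq_single c] <;> simp +contextual

end

/-! ### Reduction steps and their effect on the level. -/

section


open Complex

variable {n : ℕ}

lemma semiconj_gX_gK_apply (a b c d : Fin n) :
    SemiconjBy (gX a b) (gK c d) (gK (Equiv.swap a b c) (Equiv.swap a b d)) := by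
  by_cases hab : a = b
  · subst hab; simp [gX_self]
  by_cases hcd : c = d
  · subst hcd; simp [gK]
  rw [Equiv.swap_apply_def, Equiv.swap_apply_def]
  split_ifs with h1 h2 h3 h4 h5 h6 h7 h8
  · grind
  · subst h1 h3; exact semiconj_gX_gK_swap c d
  · subst h1; exact semiconj_gX_gK hab hcd (Ne.symm h3)
  · subst h4 h5; exact semiconj_gX_symm (semiconj_gX_gK_swap d c)
  · grind
  · subst h4; exact semiconj_gX_symm (semiconj_gX_gK hab (Ne.symm h5) hcd)
  · subst h7; exact semiconj_gX_gK' hab (Ne.symm h1) (Ne.symm h4)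
  · subst h8; exact semiconj_gX_symm (semiconj_gX_gK' hab (Ne.symm h1) (Ne.symm h4))
  · exact commute_gX_gK (Ne.symm h1) (Ne.symm h7) (Ne.symm h4) (Ne.symm h8)

lemma semiconj_gX_gI (a b c : Fin n) :
    SemiconjBy (gX a b) (gI c) (gI (Equiv.swap a b c)) := by
  rw [Equiv.swap_apply_def]
  split_ifs with h1 h2
  · subst h1; exact semiconj_gX_gI_left c b
  · subst h2; exact semiconj_gX_gI_right a c
  · exact (commute_gI_gX h1 h2).symm

/-- This is `gK_mul_gI_sq` for the inverse gate: the inverse is `gK a b * (gI a * gI b)`, and the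
factor `gI a * gI b` commutes with the swap and cancels. -/
lemma gK_mul_gX {a b : Fin n} (hab : a ≠ b) : gK a b * gX a b = gI b ^ 2 * gK a b := by
  have h1 := gK_mul_gI_sq hab
  have h2 := gK_sq_mul hab
  have h3 := commute_gK_gI_mul_gI hab
  have h4 : (gK a b)⁻¹ = gK a b * (gI a * gI b) := by
    rw [inv_eq_iff_mul_eq_one, ← mul_assoc, h2]
  have h5 : gI b ^ 2 * (gK a b)⁻¹ = (gK a b)⁻¹ * gX a b := by
    rw [eq_inv_mul_iff_mul_eq, ← mul_assoc, h1, mul_assoc, mul_inv_cancel, mul_one]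
  have h6 : Commute (gX a b) (gI a * gI b) := by
    have := (semiconj_gX_gI_left a b).mul_right (semiconj_gX_gI_right a b)
    rwa [(gI_commute b a).eq] at this
  rw [h4, ← mul_assoc, mul_assoc (gK a b), ← h6.eq, ← mul_assoc, ← mul_assoc] at h5
  exact (mul_right_cancel (mul_right_cancel (by simpa only [mul_assoc] using h5))).symm

/-- The reduction step on the entries `a`, `b` with phase `q` applies to `v`. -/
structure Red (k : ℕ) (v : Fin n → ℂ) (a b : Fin n) (q : ℕ) : Prop where
  pos : 1 ≤ k
  lde : IsLde k v
  ne : a ≠ b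
  left : a ∈ oddSet k v
  right : b ∈ oddSet k v
  cong : Cg 2 (gam ^ k * v a) (I ^ q * (gam ^ k * v b))

/-- The reduction step. -/
def redOp (a b : Fin n) (q : ℕ) : Pres n := gK a b * gI b ^ q

lemma act_redOp {a b : Fin n} (hab : a ≠ b) (q : ℕ) (v : Fin n → ℂ) (c : Fin n) :
    act (redOp a b q) v c = if c = a then (v a + I ^ q * v b) / gam
      else if c = b then (v a - I ^ q * v b) / gam else v c := by
  rw [redOp, act_mul, act_gK hab]
  simp only [act_gI_pow, if_neg hab, if_true]
  split_ifs <;> rfl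

lemma level_lt_of {k : ℕ} {v v' : Fin n → ℂ} (h : IsLde k v) {a : Fin n} (ha : a ∈ oddSet k v)
    (ha' : Ev (gam ^ k * v' a)) (hj : ∀ j, Ev (gam ^ k * v' j) ∨ v' j = v j) :
    level v' < level v := by
  refine level_lt h ?_ (Finset.card_lt_card ⟨?_, ?_⟩)
  · intro j
    rcases hj j with e | e
    · exact e.mem
    · rw [e]; exact h.1 j
  · intro j hj'
    rw [mem_oddSet] at *
    rcases hj j with e | e
    · exact absurd e hj'
    · rwa [← e]
  · intro hsub
    exact mem_oddSet.1 (hsub ha) ha'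

/-- Modulo `gam ^ 2` sum and difference agree, since 2 vanishes there. One factor `gam` is spent on
the denominator of `K`, and one is left. -/
lemma ev_of_cg {x y : ℂ} (hy : y ∈ zi) (h : Cg 2 x y) :
    Ev ((x + y) / gam) ∧ Ev ((x - y) / gam) := by
  obtain ⟨t, ht, e⟩ := h
  constructor
  · refine ⟨t - I * y, zi.sub_mem ht (zi.mul_mem I_mem_zi hy), ?_⟩
    rw [div_eq_iff gam_ne]
    linear_combination e + y * two_eq
  · refine ⟨t, ht, ?_⟩
    rw [div_eq_iff gam_ne]
    linear_combination e

lemma Red.ev {k : ℕ} {v : Fin n → ℂ} {a b : Fin n} {q : ℕ} (h : Red k v a b q) :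
    Ev (gam ^ k * ((v a + I ^ q * v b) / gam)) ∧ Ev (gam ^ k * ((v a - I ^ q * v b) / gam)) := by
  have := ev_of_cg ((I_pow_mul_mem q).2 (h.lde.1 b)) h.cong
  convert this using 2 <;> ring

lemma Red.level_lt {k : ℕ} {v : Fin n → ℂ} {a b : Fin n} {q : ℕ} (h : Red k v a b q) :
    level (act (redOp a b q) v) < level v := by
  refine level_lt_of h.lde h.left ?_ fun j => ?_
  · rw [act_redOp h.ne, if_pos rfl]; exact h.ev.1
  · rw [act_redOp h.ne]
    split_ifs
    · exact Or.inl h.ev.1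
    · exact Or.inl h.ev.2
    · exact Or.inr rfl

lemma exists_red {k : ℕ} {v : Fin n → ℂ} (hk : 1 ≤ k) (hv : IsLde k v) {a b : Fin n}
    (hab : a ≠ b) (ha : a ∈ oddSet k v) (hb : b ∈ oddSet k v) : ∃ q, Red k v a b q := by
  rcases exists_phase_two (hv.1 a) (hv.1 b) (mem_oddSet.1 ha) (mem_oddSet.1 hb) with h | h
  · exact ⟨0, hk, hv, hab, ha, hb, by simpa using h⟩
  · exact ⟨1, hk, hv, hab, ha, hb, by simpa using h⟩

lemma Red.add_two {k : ℕ} {v : Fin n → ℂ} {a b : Fin n} {q : ℕ} (h : Red k v a b q) :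
    Red k v a b (q + 2) := by
  refine ⟨h.pos, h.lde, h.ne, h.left, h.right, ?_⟩
  obtain ⟨t, ht, e⟩ := h.cong
  have hm := (I_pow_mul_mem q).2 (h.lde.1 b)
  refine ⟨t - I * (I ^ q * (gam ^ k * v b)), zi.sub_mem ht (zi.mul_mem I_mem_zi hm), ?_⟩
  rw [pow_add, I_sq]
  linear_combination e + (I ^ q * (gam ^ k * v b)) * two_eq

lemma Red.of_add_two {k : ℕ} {v : Fin n → ℂ} {a b : Fin n} {q : ℕ} (h : Red k v a b (q + 2)) :
    Red k v a b q := by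
  have := h.add_two
  refine ⟨h.pos, h.lde, h.ne, h.left, h.right, ?_⟩
  have h2 := this.cong
  rwa [show q + 2 + 2 = q + 4 from rfl, pow_add, I_pow_four, mul_one] at h2

/-- Both congruences together would make `(1 - i) y` divisible by `gam ^ 2`, hence `y` even. With
`Red.add_two`, the admissible phases for a pair form one class modulo 2. -/
lemma Red.not_zero_one {k : ℕ} {v : Fin n → ℂ} {a b : Fin n} (h : Red k v a b 0)
    (h' : Red k v a b 1) : False := by
  obtain ⟨s, hs, e⟩ := h.cong
  obtain ⟨t, ht, e'⟩ := h'.cong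
  apply mem_oddSet.1 h.right
  refine ⟨I * (t - s), zi.mul_mem I_mem_zi (zi.sub_mem ht hs), ?_⟩
  apply mul_left_cancel₀ gam_ne
  simp only [pow_zero, one_mul, pow_one] at e e'
  have hg : gam = 1 + I := rfl
  linear_combination I * (e' - e) + (gam ^ k * v b) * hg + (gam ^ k * v b) * I_sq

lemma exists_ne_mem_oddSet {k : ℕ} {v : Fin n → ℂ} (hv : IsUnitVec v) (hk : 1 ≤ k)
    (hl : IsLde k v) {a : Fin n} (ha : a ∈ oddSet k v) : ∃ b ∈ oddSet k v, b ≠ a := by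
  have h1 := hv.even_card hk hl.1
  have h2 : 0 < (oddSet k v).card := Finset.card_pos.2 ⟨a, ha⟩
  refine Finset.exists_mem_ne ?_ a
  obtain ⟨m, hm⟩ := h1
  omega

lemma exists_fourth {k : ℕ} {v : Fin n → ℂ} (hv : IsUnitVec v) (hk : 1 ≤ k)
    (hl : IsLde k v) {a b c : Fin n} (ha : a ∈ oddSet k v) (hb : b ∈ oddSet k v)
    (hc : c ∈ oddSet k v) (hab : a ≠ b) (hac : a ≠ c) (hbc : b ≠ c) :
    ∃ d ∈ oddSet k v, a ≠ d ∧ b ≠ d ∧ c ≠ d := by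
  have h1 := hv.even_card hk hl.1
  have h3 : ({a, b, c} : Finset (Fin n)).card = 3 := Finset.card_eq_three.2
    ⟨a, b, c, hab, hac, hbc, rfl⟩
  have hsub : ({a, b, c} : Finset (Fin n)) ⊆ oddSet k v := by
    intro x hx
    simp only [Finset.mem_insert, Finset.mem_singleton] at hx
    rcases hx with rfl | rfl | rfl <;> assumption
  have hle := Finset.card_le_card hsub
  obtain ⟨m, hm⟩ := h1
  obtain ⟨d, hd, hd'⟩ := Finset.exists_mem_notMem_of_card_lt_card
    (s := ({a, b, c} : Finset (Fin n))) (t := oddSet k v) (by omega)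
  simp only [Finset.mem_insert, Finset.mem_singleton, not_or] at hd'
  exact ⟨d, hd, Ne.symm hd'.1, Ne.symm hd'.2.1, Ne.symm hd'.2.2⟩

lemma oddSet_act_gI_pow (k : ℕ) (v : Fin n → ℂ) (a : Fin n) (q : ℕ) :
    oddSet k (act (gI a ^ q) v) = oddSet k v := by
  ext j
  rw [mem_oddSet, mem_oddSet, act_gI_pow]
  split_ifs with h
  · subst h; rw [mul_left_comm, ev_I_pow_mul]
  · rfl

lemma isLde_act_gI_pow {k : ℕ} {v : Fin n → ℂ} (h : IsLde k v) (a : Fin n) (q : ℕ) :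
    IsLde k (act (gI a ^ q) v) := by
  refine ⟨fun j => ?_, by rw [oddSet_act_gI_pow]; exact h.2⟩
  rw [act_gI_pow]
  split_ifs with hj
  · rw [mul_left_comm]; exact (I_pow_mul_mem q).2 (h.1 a)
  · exact h.1 j

lemma level_act_gI_pow {v : Fin n → ℂ} (h : IsUnitVec v) (a : Fin n) (q : ℕ) :
    level (act (gI a ^ q) v) = level v := by
  obtain ⟨k, hk⟩ := h.exists_isLde
  rw [hk.level_eq, (isLde_act_gI_pow hk a q).level_eq, oddSet_act_gI_pow]

lemma level_act_gI {v : Fin n → ℂ} (h : IsUnitVec v) (a : Fin n) :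
    level (act (gI a) v) = level v := by
  simpa using level_act_gI_pow h a 1

lemma mem_oddSet_act_gX {k : ℕ} {v : Fin n → ℂ} {a b j : Fin n} :
    j ∈ oddSet k (act (gX a b) v) ↔ Equiv.swap a b j ∈ oddSet k v := by
  rw [mem_oddSet, mem_oddSet, act_gX]

lemma isLde_act_gX {k : ℕ} {v : Fin n → ℂ} (h : IsLde k v) (a b : Fin n) :
    IsLde k (act (gX a b) v) := by
  refine ⟨fun j => by rw [act_gX]; exact h.1 _, h.2.imp_right ?_⟩
  rintro ⟨j, hj⟩
  exact ⟨Equiv.swap a b j, mem_oddSet_act_gX.2 (by simpa using hj)⟩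

lemma level_act_gX {v : Fin n → ℂ} (h : IsUnitVec v) (a b : Fin n) :
    level (act (gX a b) v) = level v := by
  obtain ⟨k, hk⟩ := h.exists_isLde
  rw [hk.level_eq, (isLde_act_gX hk a b).level_eq]
  congr 1
  refine Finset.card_bij' (fun j _ => Equiv.swap a b j) (fun j _ => Equiv.swap a b j)
    (fun j hj => mem_oddSet_act_gX.1 hj) (fun j hj => mem_oddSet_act_gX.2 (by simpa using hj))
    (by simp) (by simp)

/-! ### The section over the unit vectors, and its independence of the chosen reduction step. -/

variable {Y : Type*} [MulAction (Pres (n + 1)) Y]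

/-- The generators that do not involve the last index fix `y`. -/
structure FixesLower (n : ℕ) {Y : Type*} [MulAction (Pres (n + 1)) Y] (y : Y) : Prop where
  smul_gI : ∀ a : Fin (n + 1), a ≠ Fin.last n → gI a • y = y
  smul_gX : ∀ a b : Fin (n + 1), a ≠ Fin.last n → b ≠ Fin.last n → gX a b • y = y
  smul_gK : ∀ a b : Fin (n + 1), a ≠ Fin.last n → b ≠ Fin.last n → gK a b • y = y

/-- The point over the vector `i ^ p e_c`. -/
def basePt (y : Y) (c : Fin (n + 1)) (p : ℕ) : Y := gI c ^ p • gX c (Fin.last n) • y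

open Classical in
/-- The equivariant section over the unit vectors. -/
def sig (y : Y) (v : Fin (n + 1) → ℂ) : Y :=
  -- The step is an arbitrary choice; that all choices agree on unit vectors is proved below. The
  -- final default `y` is never reached on a unit vector.
  if h : ∃ s : ℕ × Fin (n + 1) × Fin (n + 1) × ℕ, Red s.1 v s.2.1 s.2.2.1 s.2.2.2 then
    (redOp h.choose.2.1 h.choose.2.2.1 h.choose.2.2.2)⁻¹ •
      sig y (act (redOp h.choose.2.1 h.choose.2.2.1 h.choose.2.2.2) v)
  else if h : ∃ s : Fin (n + 1) × ℕ, v = Pi.single s.1 (I ^ s.2) then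
    basePt y h.choose.1 h.choose.2
  else y
termination_by level v
decreasing_by exact h.choose_spec.level_lt

/-- The value of the section obtained by the step `r`. -/
def via (y : Y) (v : Fin (n + 1) → ℂ) (r : Pres (n + 1)) : Y := r⁻¹ • sig y (act r v)

/-- The section is compatible with `g` at `v`. -/
def Eqv (y : Y) (g : Pres (n + 1)) (v : Fin (n + 1) → ℂ) : Prop := g • sig y v = sig y (act g v)

lemma Eqv.mul {y : Y} {g h : Pres (n + 1)} {v : Fin (n + 1) → ℂ} (h1 : Eqv y g (act h v))
    (h2 : Eqv y h v) : Eqv y (g * h) v := by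
  rw [Eqv, mul_smul, h2, h1, act_mul]

lemma eqv_one (y : Y) (v : Fin (n + 1) → ℂ) : Eqv y 1 v := by
  rw [Eqv, one_smul, act_one]

/-- Following a step by an element already compatible at its endpoint changes nothing. Independence
of the step is therefore a matter of factoring group elements. -/
lemma via_mul {y : Y} {r h : Pres (n + 1)} {v : Fin (n + 1) → ℂ} (e : Eqv y h (act r v)) :
    via y v (h * r) = via y v r := by
  rw [via, act_mul, ← e, mul_inv_rev, mul_smul, inv_smul_smul, via]

lemma via_mul_right (y : Y) (r d : Pres (n + 1)) (v : Fin (n + 1) → ℂ) :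
    via y v (r * d) = d⁻¹ • via y (act d v) r := by
  rw [via, via, act_mul, mul_inv_rev, mul_smul]

/-- The section is compatible with all generators below level `l`. -/
structure EqvBelow (n : ℕ) {Y : Type*} [MulAction (Pres (n + 1)) Y] (y : Y) (l : ℕ) : Prop where
  eqv_gI : ∀ v : Fin (n + 1) → ℂ, IsUnitVec v → level v < l → ∀ a, Eqv y (gI a) v
  eqv_gX : ∀ v : Fin (n + 1) → ℂ, IsUnitVec v → level v < l → ∀ a b, Eqv y (gX a b) v
  eqv_gK : ∀ v : Fin (n + 1) → ℂ, IsUnitVec v → level v < l → ∀ a b, a ≠ b → level (act (gK a b) v) < l →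
    Eqv y (gK a b) v

variable {y : Y} {l : ℕ} {v : Fin (n + 1) → ℂ}

lemma EqvBelow.eqv_gI_pow (H : EqvBelow n y l) (hv : IsUnitVec v) (hl : level v < l) (a : Fin (n + 1))
    (q : ℕ) : Eqv y (gI a ^ q) v := by
  induction q with
  | zero => rw [pow_zero]; exact eqv_one y v
  | succ q ih =>
    rw [pow_succ']
    exact (H.eqv_gI _ (hv.act _) (by rwa [level_act_gI_pow hv]) a).mul ih

lemma EqvBelow.eqv_gI_pow_mul (H : EqvBelow n y l) (hv : IsUnitVec v) (hl : level v < l)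
    (a b : Fin (n + 1)) (p q : ℕ) : Eqv y (gI a ^ p * gI b ^ q) v :=
  (H.eqv_gI_pow (hv.act _) (by rwa [level_act_gI_pow hv]) a p).mul (H.eqv_gI_pow hv hl b q)

lemma EqvBelow.eqv_redOp (H : EqvBelow n y l) (hv : IsUnitVec v) (hl : level v < l)
    {a b : Fin (n + 1)} (hab : a ≠ b) (q : ℕ) (h : level (act (redOp a b q) v) < l) :
    Eqv y (redOp a b q) v := by
  refine (H.eqv_gK _ (hv.act _) (by rwa [level_act_gI_pow hv]) a b hab ?_).mul (H.eqv_gI_pow hv hl b q)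
  rwa [← act_mul]

/-- The phase of a reduction step does not matter. -/
lemma EqvBelow.via_phase (H : EqvBelow n y (level v)) (hv : IsUnitVec v) {k : ℕ}
    {a b : Fin (n + 1)} {q q' : ℕ} (h : Red k v a b q) (h' : Red k v a b q') :
    via y v (redOp a b q) = via y v (redOp a b q') := by
  have step : ∀ q, Red k v a b q → via y v (redOp a b (q + 2)) = via y v (redOp a b q) := by
    intro q h
    have : redOp a b (q + 2) = gX a b * redOp a b q := by
      rw [redOp, redOp, add_comm q 2, pow_add, ← mul_assoc, gK_mul_gI_sq h.ne, mul_assoc]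
    rw [this]
    exact via_mul (H.eqv_gX _ (hv.act _) h.level_lt a b)
  -- Both phases come down to 0 or 1 in steps of two, and `Red.not_zero_one` forces the same end.
  have red : ∀ q, Red k v a b q → ∃ e, (e = 0 ∨ e = 1) ∧ Red k v a b e ∧
      via y v (redOp a b q) = via y v (redOp a b e) := by
    intro q
    induction q using Nat.twoStepInduction with
    | zero => exact fun h => ⟨0, Or.inl rfl, h, rfl⟩
    | one => exact fun h => ⟨1, Or.inr rfl, h, rfl⟩
    | more q ih _ =>
      intro h
      obtain ⟨e, he, hr, hv⟩ := ih h.of_add_two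
      exact ⟨e, he, hr, (step q h.of_add_two).trans hv⟩
  obtain ⟨e, he, hr, h1⟩ := red q h
  obtain ⟨e', he', hr', h1'⟩ := red q' h'
  rw [h1, h1']
  rcases he with rfl | rfl <;> rcases he' with rfl | rfl
  · rfl
  · exact (hr.not_zero_one hr').elim
  · exact (hr'.not_zero_one hr).elim
  · rfl

/-- The order of the two indices of a reduction step does not matter. -/
lemma EqvBelow.via_swap (H : EqvBelow n y (level v)) (hv : IsUnitVec v) {k : ℕ}
    {a b : Fin (n + 1)} {q : ℕ} (h : Red k v a b q) :
    ∃ q', Red k v b a q' ∧ via y v (redOp b a q') = via y v (redOp a b q) := by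
  -- Here `3 * q` stands for the inverse phase `-q`. The extra 2 compensates the `gI b ^ 2` that
  -- arises when `gX a b` is moved across `gK a b`.
  refine ⟨3 * q + 2, Red.add_two ⟨h.pos, h.lde, h.ne.symm, h.right, h.left, ?_⟩, ?_⟩
  · obtain ⟨t, ht, e⟩ := h.cong
    refine ⟨-(I ^ (3 * q) * t), zi.neg_mem ((I_pow_mul_mem _).2 ht), ?_⟩
    have h4 : I ^ (3 * q) * I ^ q = 1 := by
      rw [← pow_add, show 3 * q + q = 4 * q by ring, pow_mul, I_pow_four, one_pow]
    linear_combination -(I ^ (3 * q)) * e - (gam ^ k * v b) * h4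
  · have hc : gK b a * gI a ^ (3 * q + 2)
        = gI b ^ (2 + 3 * q) * gI a ^ (3 * q) * (gK a b * gI b ^ q) := by
      have e1 : gX a b * gI a ^ (3 * q + 2) = gI b ^ (3 * q + 2) * gX a b :=
        ((semiconj_gX_gI_left a b).pow_right _).eq
      have e2 : gI b ^ (3 * q) * gX a b = gX a b * gI a ^ (3 * q) :=
        ((semiconj_gX_gI_left a b).pow_right _).eq.symm
      have e3 : gI a ^ (3 * q) = (gI a * gI b) ^ (3 * q) * gI b ^ q := by
        rw [(gI_commute a b).mul_pow, mul_assoc, ← pow_add, show 3 * q + q = 4 * q by ring,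
          pow_mul (gI b), gI_pow_four, one_pow, mul_one]
      have e4 := ((commute_gK_gI_mul_gI h.ne).pow_right (3 * q)).eq
      calc gK b a * gI a ^ (3 * q + 2)
          = (gX a b * gK a b) * (gX a b * gI a ^ (3 * q + 2)) := by
            rw [gK_swap a b]; simp only [mul_assoc]
        _ = gK a b * (gI b ^ 2 * gI b ^ (3 * q + 2)) * gX a b := by
            rw [e1, ← gK_mul_gI_sq h.ne]; simp only [mul_assoc]
        _ = gK a b * (gI b ^ (3 * q) * gX a b) := by
            rw [← pow_add, show 2 + (3 * q + 2) = 4 + 3 * q by ring, pow_add, gI_pow_four, one_mul,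
              mul_assoc]
        _ = (gK a b * gX a b) * gI a ^ (3 * q) := by rw [e2, mul_assoc]
        _ = gI b ^ 2 * (gK a b * (gI a * gI b) ^ (3 * q)) * gI b ^ q := by
            rw [gK_mul_gX h.ne, e3]; simp only [mul_assoc]
        _ = _ := by
            rw [e4, (gI_commute a b).mul_pow, ((gI_commute a b).pow_pow _ _).eq, pow_add]
            simp only [mul_assoc]
    rw [redOp, hc]
    exact via_mul (H.eqv_gI_pow_mul (hv.act _) h.level_lt b a _ _)

lemma redOp_commute {a b c d : Fin n} (h1 : a ≠ c) (h2 : a ≠ d) (h3 : b ≠ c)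
    (h4 : b ≠ d) (q q' : ℕ) : Commute (redOp a b q) (redOp c d q') := by
  have e1 := commute_gK_gK h1 h2 h3 h4
  have e2 := ((commute_gI_gK h2.symm h4.symm).symm.pow_right q')
  have e3 := (commute_gI_gK h3 h4).pow_left q
  have e4 := (gI_commute b d).pow_pow q q'
  exact (e1.mul_right e2).mul_left (e3.mul_right e4)

/-- Reduction steps on disjoint pairs of indices agree. -/
lemma EqvBelow.via_disjoint (H : EqvBelow n y (level v)) (hv : IsUnitVec v) {k : ℕ}
    {a b c d : Fin (n + 1)} {q q' : ℕ} (h : Red k v a b q) (h' : Red k v c d q')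
    (h1 : a ≠ c) (h2 : a ≠ d) (h3 : b ≠ c) (h4 : b ≠ d) :
    via y v (redOp a b q) = via y v (redOp c d q') := by
  have hl : level (act (redOp a b q) (act (redOp c d q') v)) < level v := by
    have e1 := h.ev
    have e2 := h'.ev
    refine level_lt_of h.lde h.left ?_ fun j => ?_
    · simp only [act_redOp h.ne, act_redOp h'.ne, if_neg h1, if_neg h2, if_neg h3, if_neg h4]
      exact e1.1
    · simp only [act_redOp h.ne, act_redOp h'.ne, if_neg h1, if_neg h2, if_neg h3, if_neg h4]
      split_ifs
      · exact Or.inl e1.1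
      · exact Or.inl e1.2
      · exact Or.inl e2.1
      · exact Or.inl e2.2
      · exact Or.inr rfl
  have hc := (redOp_commute h1 h2 h3 h4 q q').eq
  have hl' : level (act (redOp c d q') (act (redOp a b q) v)) < level v := by
    rwa [← act_mul, ← hc, act_mul]
  -- Both steps extend to the same commuting product, and every vector on either path is below the
  -- level of `v`.
  rw [← via_mul (H.eqv_redOp (hv.act _) h.level_lt h'.ne q' hl'), ← hc,
    via_mul (H.eqv_redOp (hv.act _) h'.level_lt h.ne q hl)]

/-- The chain of `K` gates on four congruent entries stays below the level of `v`. -/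
lemma EqvBelow.via_chain (H : EqvBelow n y (level v)) (hv : IsUnitVec v) {k : ℕ} (hk : IsLde k v)
    {a b c d : Fin (n + 1)} (ha : a ∈ oddSet k v)
    (hab : a ≠ b) (hac : a ≠ c) (had : a ≠ d) (hbc : b ≠ c) (hbd : b ≠ d) (hcd : c ≠ d)
    (hb : Cg 3 (gam ^ k * v a) (gam ^ k * v b)) (hc : Cg 3 (gam ^ k * v a) (gam ^ k * v c))
    (hd : Cg 3 (gam ^ k * v a) (gam ^ k * v d)) :
    via y v (gK a b) = via y v (gK a c * (gK b d * (gK c d * gK a b))) := by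
  obtain ⟨s, hs, es⟩ := hb
  obtain ⟨t, ht, et⟩ := hc
  obtain ⟨u, hu, eu⟩ := hd
  have hx := hk.1 a
  have m1 : ∀ {z}, z ∈ zi → gam * z ∈ zi := fun h => zi.mul_mem gam_mem h
  have m2 : ∀ {z}, z ∈ zi → I * z ∈ zi := fun h => zi.mul_mem I_mem_zi h
  -- After the gates on `a, b` and `c, d`, the numerators at `b` and `d` are divisible by `gam ^ 2`,
  -- and those at `a` and `c` agree modulo `gam ^ 2`. So the gates on `b, d` and `a, c` still
  -- produce even numerators. This is where congruence modulo `gam ^ 3` is needed.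
  have e1a : gam ^ k * ((v a + v b) / gam) = gam * (-(I * (gam ^ k * v a)) - gam * s) := by
    rw [← mul_div_assoc, div_eq_iff gam_ne]
    linear_combination -es + (gam ^ k * v a) * two_eq
  have e1b : gam ^ k * ((v a - v b) / gam) = gam * (gam * s) := by
    rw [← mul_div_assoc, div_eq_iff gam_ne]
    linear_combination es
  have e1c : gam ^ k * ((v c + v d) / gam) = gam * (-(I * (gam ^ k * v a)) - gam * (t + u)) := by
    rw [← mul_div_assoc, div_eq_iff gam_ne]
    linear_combination -et - eu + (gam ^ k * v a) * two_eq
  have e1d : gam ^ k * ((v c - v d) / gam) = gam * (gam * (u - t)) := by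
    rw [← mul_div_assoc, div_eq_iff gam_ne]
    linear_combination eu - et
  have e2b : gam ^ k * (((v a - v b) / gam + (v c - v d) / gam) / gam) = gam * (s + (u - t)) := by
    rw [← mul_div_assoc, div_eq_iff gam_ne]
    linear_combination e1b + e1d
  have e2d : gam ^ k * (((v a - v b) / gam - (v c - v d) / gam) / gam) = gam * (s - (u - t)) := by
    rw [← mul_div_assoc, div_eq_iff gam_ne]
    linear_combination e1b - e1d
  have e2a : gam ^ k * (((v a + v b) / gam + (v c + v d) / gam) / gam)
      = gam * (-(gam * (gam ^ k * v a)) - (s + (t + u))) := by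
    rw [← mul_div_assoc, div_eq_iff gam_ne]
    linear_combination e1a + e1c - gam * I * (gam ^ k * v a) * two_eq
      + gam ^ 3 * (gam ^ k * v a) * I_sq
  have e2c : gam ^ k * (((v a + v b) / gam - (v c + v d) / gam) / gam)
      = gam * (t + u - s) := by
    rw [← mul_div_assoc, div_eq_iff gam_ne]
    linear_combination e1a - e1c
  have E : ∀ {z w}, w ∈ zi → z = gam * w → Ev z := fun h e => ⟨_, h, e⟩
  have v1a := E (zi.sub_mem (zi.neg_mem (m2 hx)) (m1 hs)) e1a
  have v1b := E (m1 hs) e1b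
  have v1c := E (zi.sub_mem (zi.neg_mem (m2 hx)) (m1 (zi.add_mem ht hu))) e1c
  have v1d := E (m1 (zi.sub_mem hu ht)) e1d
  have v2a := E (zi.sub_mem (zi.neg_mem (m1 hx)) (zi.add_mem hs (zi.add_mem ht hu))) e2a
  have v2b := E (zi.add_mem hs (zi.sub_mem hu ht)) e2b
  have v2c := E (zi.sub_mem (zi.add_mem ht hu) hs) e2c
  have v2d := E (zi.sub_mem hs (zi.sub_mem hu ht)) e2d
  have l1 : level (act (gK a b) v) < level v := by
    refine level_lt_of hk ha ?_ fun j => ?_ <;> simp only [act_gK hab]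
    · simpa using v1a
    · split_ifs <;> first | exact Or.inr rfl | (left; assumption)
  have l2 : level (act (gK c d) (act (gK a b) v)) < level v := by
    refine level_lt_of hk ha ?_ fun j => ?_ <;>
      simp only [act_gK hab, act_gK hcd, if_neg hac, if_neg had, if_neg hac.symm, if_neg had.symm,
        if_neg hbc.symm, if_neg hbd.symm]
    · simpa using v1a
    · split_ifs <;> first | exact Or.inr rfl | (left; assumption)
  have l3 : level (act (gK b d) (act (gK c d) (act (gK a b) v))) < level v := by
    refine level_lt_of hk ha ?_ fun j => ?_ <;>
      simp only [act_gK hab, act_gK hcd, act_gK hbd, if_neg hac, if_neg had, if_neg hac.symm,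
        if_neg had.symm, if_neg hbc.symm, if_neg hbd.symm, if_neg hab.symm, if_neg hbc,
        if_neg hbd, if_neg hab, if_neg hcd.symm, if_true]
    · exact v1a
    · split_ifs <;> first | exact Or.inr rfl | (left; assumption)
  have l4 : level (act (gK a c) (act (gK b d) (act (gK c d) (act (gK a b) v)))) < level v := by
    refine level_lt_of hk ha ?_ fun j => ?_ <;>
      simp only [act_gK hab, act_gK hcd, act_gK hbd, act_gK hac, if_neg hac, if_neg had,
        if_neg hac.symm, if_neg had.symm, if_neg hbc.symm, if_neg hbd.symm, if_neg hab.symm,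
        if_neg hbc, if_neg hbd, if_neg hab, if_neg hcd.symm, if_neg hcd, if_true]
    · exact v2a
    · split_ifs <;> first | exact Or.inr rfl | (left; assumption)
  have x1 := H.eqv_gK _ (hv.act _) l1 c d hcd l2
  have x2 := H.eqv_gK _ ((hv.act _).act _) l2 b d hbd l3
  have x3 := H.eqv_gK _ (((hv.act _).act _).act _) l3 a c hac l4
  rw [via_mul (by rwa [act_mul, act_mul]), via_mul (by rwa [act_mul]), via_mul x1]

/-- Reduction steps on overlapping pairs of indices agree. -/
lemma EqvBelow.via_overlap (H : EqvBelow n y (level v)) (hv : IsUnitVec v) {k : ℕ}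
    {a b c : Fin (n + 1)} {q q' : ℕ} (h : Red k v a b q) (h' : Red k v a c q') (hbc : b ≠ c) :
    via y v (redOp a b q) = via y v (redOp a c q') := by
  have hab := h.ne
  have hac := h'.ne
  -- Three odd entries force a fourth, which makes the four-index relation applicable.
  obtain ⟨d, hd, had, hbd, hcd⟩ :=
    exists_fourth hv h.pos h.lde h.left h.right h'.right hab hac hbc
  have odd : ∀ j ∈ oddSet k v, ∃ q, Cg 3 (gam ^ k * v a) (I ^ q * (gam ^ k * v j)) := fun j hj =>
    exists_phase_three (h.lde.1 a) (h.lde.1 j) (mem_oddSet.1 h.left) (mem_oddSet.1 hj)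
  obtain ⟨p1, hp1⟩ := odd b h.right
  obtain ⟨p2, hp2⟩ := odd c h'.right
  obtain ⟨p3, hp3⟩ := odd d hd
  have r1 : Red k v a b p1 := ⟨h.pos, h.lde, hab, h.left, h.right, hp1.mono⟩
  have r2 : Red k v a c p2 := ⟨h.pos, h.lde, hac, h.left, h'.right, hp2.mono⟩
  rw [H.via_phase hv h r1, H.via_phase hv h' r2]
  -- The phases in `D` make the entries at `b`, `c`, `d` congruent modulo `gam ^ 3` to the one at
  -- `a`, without changing the level.
  set D : Pres (n + 1) := gI b ^ p1 * gI c ^ p2 * gI d ^ p3 with hD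
  have c1 : gK a b * D = (gI c ^ p2 * gI d ^ p3) * redOp a b p1 := by
    have e1 := (commute_gI_gK hac.symm hbc.symm).pow_left p2
    have e2 := (commute_gI_gK had.symm hbd.symm).pow_left p3
    have e3 := (gI_commute c b).pow_pow p2 p1
    have e4 := (gI_commute d b).pow_pow p3 p1
    rw [hD, redOp, ((e1.mul_left e2).mul_right (e3.mul_left e4)).eq]
    simp only [mul_assoc]
  have c2 : gK a c * D = (gI b ^ p1 * gI d ^ p3) * redOp a c p2 := by
    have e1 := (commute_gI_gK hab.symm hbc).pow_left p1
    have e2 := (commute_gI_gK had.symm hcd.symm).pow_left p3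
    have e3 := (gI_commute b c).pow_pow p1 p2
    have e4 := (gI_commute d c).pow_pow p3 p2
    rw [hD, redOp, ((e1.mul_left e2).mul_right (e3.mul_left e4)).eq, e3.eq]
    simp only [mul_assoc]
  have w1 : via y v (gK a b * D) = via y v (redOp a b p1) := by
    rw [c1]; exact via_mul (H.eqv_gI_pow_mul (hv.act _) r1.level_lt _ _ _ _)
  have w2 : via y v (gK a c * D) = via y v (redOp a c p2) := by
    rw [c2]; exact via_mul (H.eqv_gI_pow_mul (hv.act _) r2.level_lt _ _ _ _)
  rw [← w1, ← w2, via_mul_right, via_mul_right]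
  congr 1
  have hDv : act D v = act (gI b ^ p1) (act (gI c ^ p2) (act (gI d ^ p3) v)) := by
    rw [hD, act_mul, act_mul]
  have hval : ∀ j, act D v j = if j = b then I ^ p1 * v b else if j = c then I ^ p2 * v c
      else if j = d then I ^ p3 * v d else v j := by
    intro j
    simp only [hDv, act_gI_pow, if_neg hbc, if_neg hbd, if_neg hcd]
  have hlev : level (act D v) = level v := by
    rw [hDv, level_act_gI_pow ((hv.act _).act _), level_act_gI_pow (hv.act _),
      level_act_gI_pow hv]
  have hlde : IsLde k (act D v) := by
    rw [hDv]
    exact isLde_act_gI_pow (isLde_act_gI_pow (isLde_act_gI_pow h.lde _ _) _ _) _ _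
  have hodd : a ∈ oddSet k (act D v) := by
    rw [hDv, oddSet_act_gI_pow, oddSet_act_gI_pow, oddSet_act_gI_pow]; exact h.left
  have va : act D v a = v a := by rw [hval]; simp [hab, hac, had]
  have vb : Cg 3 (gam ^ k * act D v a) (gam ^ k * act D v b) := by
    rw [va, hval, if_pos rfl, mul_left_comm]; exact hp1
  have vc : Cg 3 (gam ^ k * act D v a) (gam ^ k * act D v c) := by
    rw [va, hval, if_neg hbc.symm, if_pos rfl, mul_left_comm]; exact hp2
  have vd : Cg 3 (gam ^ k * act D v a) (gam ^ k * act D v d) := by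
    rw [va, hval, if_neg hbd.symm, if_neg hcd.symm, if_pos rfl, mul_left_comm]; exact hp3
  have H' : EqvBelow n y (level (act D v)) := by rwa [hlev]
  rw [H'.via_chain (hv.act _) hlde hodd hab hac had hbc hbd hcd vb vc vd,
    H'.via_chain (hv.act _) hlde hodd hac hab had hbc.symm hcd hbd vc vb vd]
  congr 1
  -- The two chains are the same group element: `gK_four`, up to commuting `K` gates on disjoint
  -- pairs.
  have f := gK_four hab hac had hbc hbd hcd
  have k1 := (commute_gK_gK hac had hbc hbd).eq
  have k2 := (commute_gK_gK hab had hbc.symm hcd).eq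
  simp only [mul_assoc] at f
  rw [← k1, ← f, ← k2]

/-- All reduction steps agree. -/
lemma EqvBelow.via_eq (H : EqvBelow n y (level v)) (hv : IsUnitVec v) {k : ℕ}
    {a b c d : Fin (n + 1)} {q q' : ℕ} (h : Red k v a b q) (h' : Red k v c d q') :
    via y v (redOp a b q) = via y v (redOp c d q') := by
  obtain ⟨p, hp, ep⟩ := H.via_swap hv h
  obtain ⟨p', hp', ep'⟩ := H.via_swap hv h'
  by_cases h1 : a = c
  · subst h1
    by_cases h4 : b = d
    · subst h4; exact H.via_phase hv h h'
    · exact H.via_overlap hv h h' h4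
  · by_cases h2 : a = d
    · subst h2
      rw [← ep']
      by_cases h4 : b = c
      · subst h4; exact H.via_phase hv h hp'
      · exact H.via_overlap hv h hp' h4
    · by_cases h3 : b = c
      · subst h3
        rw [← ep]
        exact H.via_overlap hv hp h' h2
      · by_cases h4 : b = d
        · subst h4
          rw [← ep, ← ep']
          exact H.via_overlap hv hp hp' h1
        · exact H.via_disjoint hv h h' h1 h2 h3 h4

lemma EqvBelow.sig_eq (H : EqvBelow n y (level v)) (hv : IsUnitVec v) {k : ℕ}
    {a b : Fin (n + 1)} {q : ℕ} (h : Red k v a b q) : sig y v = via y v (redOp a b q) := by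
  have hex : ∃ s : ℕ × Fin (n + 1) × Fin (n + 1) × ℕ, Red s.1 v s.2.1 s.2.2.1 s.2.2.2 :=
    ⟨(k, a, b, q), h⟩
  rw [sig, dif_pos hex]
  have hs := hex.choose_spec
  have hk : hex.choose.1 = k := le_antisymm (hs.lde.le h.lde.1) (h.lde.le hs.lde.1)
  have hs' : Red k v hex.choose.2.1 hex.choose.2.2.1 hex.choose.2.2.2 := hk ▸ hs
  exact H.via_eq hv hs' h

end

/-! ### Compatibility with the generators on basis vectors. -/

section


open Complex

lemma gI_pow_mod {n : ℕ} (c : Fin n) (p : ℕ) : gI c ^ p = gI c ^ (p % 4) := by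
  conv_lhs => rw [← Nat.div_add_mod p 4, pow_add, pow_mul, gI_pow_four, one_pow, one_mul]

lemma gI_pow_eq {n : ℕ} (c : Fin n) {p q : ℕ} (h : I ^ p = I ^ q) : gI c ^ p = gI c ^ q := by
  have hne : I ≠ 1 := fun h => by simpa using congrArg re h
  have hne' : I ≠ -1 := fun h => by simpa using congrArg re h
  have hne'' : I ≠ -I := fun h => by
    have := congrArg im h
    norm_num at this
  have h1 : (1 : ℂ) ≠ -1 := by norm_num
  rw [gI_pow_mod c p, gI_pow_mod c q]
  rw [I_pow_eq_pow_mod p, I_pow_eq_pow_mod q] at h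
  have hp := Nat.mod_lt p (show 0 < 4 by norm_num)
  have hq := Nat.mod_lt q (show 0 < 4 by norm_num)
  generalize p % 4 = p at *
  generalize q % 4 = q at *
  interval_cases p <;> interval_cases q <;>
    simp only [pow_zero, pow_one, I_sq, I_pow_three] at h ⊢ <;> exfalso <;> grind

variable {n : ℕ}

lemma act_gI_pow_single (a c : Fin n) (q : ℕ) (z : ℂ) :
    act (gI a ^ q) (Pi.single c z) = Pi.single c (if a = c then I ^ q * z else z) := by
  ext j
  rw [act_gI_pow]
  by_cases h1 : j = a <;> by_cases h2 : a = c
  · subst h1 h2; simp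
  · subst h1; simp [h2]
  · subst h2; simp [h1]
  · simp [h1, h2]

lemma act_gX_single (a b c : Fin n) (z : ℂ) :
    act (gX a b) (Pi.single c z) = Pi.single (Equiv.swap a b c) z := by
  ext j
  rw [act_gX]
  by_cases h : j = Equiv.swap a b c
  · subst h; simp
  · rw [Pi.single_eq_of_ne h, Pi.single_eq_of_ne]
    rintro rfl
    simp at h

lemma adm_zero_single (c : Fin n) (p : ℕ) : Adm 0 (Pi.single c (I ^ p) : Fin n → ℂ) := by
  intro j
  by_cases h : j = c
  · subst h; simpa using (I_pow_mul_mem p).2 zi.one_mem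
  · simp [h]

variable {Y : Type*} [MulAction (Pres (n + 1)) Y] {y : Y} {v : Fin (n + 1) → ℂ}

lemma sig_single (c : Fin (n + 1)) (p : ℕ) :
    sig y (Pi.single c (I ^ p)) = basePt y c p := by
  have hex : ∃ s : Fin (n + 1) × ℕ,
      (Pi.single c (I ^ p) : Fin (n + 1) → ℂ) = Pi.single s.1 (I ^ s.2) := ⟨(c, p), rfl⟩
  rw [sig, dif_neg, dif_pos hex]
  · have hs := hex.choose_spec
    have hc : c = hex.choose.1 := by
      by_contra hne
      have := congrFun hs c
      rw [Pi.single_eq_same, Pi.single_eq_of_ne hne] at this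
      exact pow_ne_zero p I_ne_zero this
    rw [← hc] at hs ⊢
    have hp : I ^ p = I ^ hex.choose.2 := by simpa using congrFun hs c
    rw [basePt, basePt, gI_pow_eq c hp]
  · rintro ⟨s, hs⟩
    have := hs.lde.le (adm_zero_single c p)
    have := hs.pos
    omega

lemma FixesLower.eqv_gI_single (F : FixesLower n y) (a c : Fin (n + 1)) (p : ℕ) :
    Eqv y (gI a) (Pi.single c (I ^ p)) := by
  have hact := act_gI_pow_single a c 1 (I ^ p)
  rw [pow_one, pow_one] at hact
  rw [Eqv, hact, sig_single]
  by_cases h : a = c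
  · subst h
    rw [if_pos rfl, ← pow_succ', sig_single, basePt, basePt, smul_smul, pow_succ']
  · rw [if_neg h, sig_single, basePt, smul_smul, ((gI_commute a c).pow_right p).eq, ← smul_smul]
    congr 1
    rw [smul_smul]
    by_cases hl : a = Fin.last n
    · subst hl
      rw [← (semiconj_gX_gI_left c (Fin.last n)).eq, ← smul_smul, F.smul_gI c (Ne.symm h)]
    · rw [(commute_gI_gX h hl).eq, ← smul_smul, F.smul_gI a hl]

/-- Swaps permute the points `gX c (Fin.last n) • y` as they permute the indices `c`: the product of
swaps is rewritten so that one on lower indices stands next to `y` and is absorbed. -/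
lemma FixesLower.gX_smul_base (F : FixesLower n y) (a b c : Fin (n + 1)) :
    gX a b • gX c (Fin.last n) • y = gX (Equiv.swap a b c) (Fin.last n) • y := by
  have key : ∀ a, a ≠ Fin.last n → gX a (Fin.last n) • gX c (Fin.last n) • y
      = gX (Equiv.swap a (Fin.last n) c) (Fin.last n) • y := by
    intro a ha
    by_cases h1 : c = a
    · subst h1
      rw [smul_smul, gX_mul_self, Equiv.swap_apply_left, gX_self]
    by_cases h2 : c = Fin.last n
    · subst h2
      rw [gX_self, one_smul, Equiv.swap_apply_right]
    · rw [Equiv.swap_apply_of_ne_of_ne h1 h2, smul_smul, gX_comm a,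
        ← (semiconj_gX_gX h2 h1 (Ne.symm ha)).eq, ← smul_smul, F.smul_gX c a h2 ha]
  by_cases ha : a = Fin.last n
  · subst ha
    by_cases hb : b = Fin.last n
    · subst hb; simp [gX_self]
    · rw [gX_comm, Equiv.swap_comm]; exact key b hb
  by_cases hb : b = Fin.last n
  · subst hb; exact key a ha
  by_cases hab : a = b
  · subst hab; simp [gX_self]
  by_cases h1 : c = a
  · subst h1
    rw [smul_smul, (semiconj_gX_gX hab ha hb).eq, ← smul_smul, F.smul_gX _ _ ha hb,
      Equiv.swap_apply_left]
  by_cases h2 : c = b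
  · subst h2
    rw [smul_smul, (semiconj_gX_symm (semiconj_gX_gX hab ha hb)).eq, ← smul_smul,
      F.smul_gX _ _ ha hb, Equiv.swap_apply_right]
  · rw [smul_smul, (commute_gX_gX (Ne.symm h1) ha (Ne.symm h2) hb).eq, ← smul_smul,
      F.smul_gX _ _ ha hb, Equiv.swap_apply_of_ne_of_ne h1 h2]

lemma FixesLower.eqv_gX_single (F : FixesLower n y) (a b c : Fin (n + 1)) (p : ℕ) :
    Eqv y (gX a b) (Pi.single c (I ^ p)) := by
  rw [Eqv, act_gX_single, sig_single, sig_single, basePt, basePt, smul_smul,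
    ((semiconj_gX_gI a b c).pow_right p).eq, ← smul_smul, F.gX_smul_base]

lemma FixesLower.eqv_gK_single (F : FixesLower n y) {a b c : Fin (n + 1)} (hab : a ≠ b)
    (ha : c ≠ a) (hb : c ≠ b) (p : ℕ) : Eqv y (gK a b) (Pi.single c (I ^ p)) := by
  have hact : act (gK a b) (Pi.single c (I ^ p)) = Pi.single c (I ^ p) := by
    ext j
    rw [act_gK hab, Pi.single_eq_of_ne (Ne.symm ha), Pi.single_eq_of_ne (Ne.symm hb)]
    split_ifs with h1 h2
    · subst h1; rw [Pi.single_eq_of_ne (Ne.symm ha)]; simp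
    · subst h2; rw [Pi.single_eq_of_ne (Ne.symm hb)]; simp
    · rfl
  rw [Eqv, hact, sig_single, basePt, smul_smul, ((commute_gI_gK ha hb).pow_left p).symm.eq,
    ← smul_smul]
  congr 1
  rw [smul_smul]
  by_cases hl : a = Fin.last n
  · subst hl
    rw [← (semiconj_gX_gK ha hb hab).eq, ← smul_smul, F.smul_gK c b ha (Ne.symm hab)]
  by_cases hl' : b = Fin.last n
  · subst hl'
    rw [← (semiconj_gX_gK' hb ha (Ne.symm hab)).eq, ← smul_smul, F.smul_gK a c hl hb]
  · rw [← (commute_gX_gK ha hb (Ne.symm hl) (Ne.symm hl')).eq, ← smul_smul, F.smul_gK a b hl hl']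

/-! ### Compatibility with the generators at a given level. -/

/-- Compatibility passes up along reduction steps intertwined by `g`. -/
lemma Eqv.of_red {g : Pres (n + 1)} (H : EqvBelow n y (level v))
    (H' : EqvBelow n y (level (act g v))) (hv : IsUnitVec v) {k k' : ℕ}
    {a b a' b' : Fin (n + 1)} {q q' : ℕ} (h : Red k v a b q) (h' : Red k' (act g v) a' b' q')
    (hc : SemiconjBy g (redOp a b q) (redOp a' b' q')) (he : Eqv y g (act (redOp a b q) v)) :
    Eqv y g v := by
  rw [Eqv, H.sig_eq hv h, H'.sig_eq (hv.act g) h', via, via, ← act_mul, ← hc.eq, act_mul, ← he,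
    smul_smul, smul_smul, (hc.inv_right).eq]

lemma EqvBelow.mono {l l' : ℕ} (H : EqvBelow n y l) (h : l' ≤ l) : EqvBelow n y l' :=
  ⟨fun v hv hl => H.eqv_gI v hv (hl.trans_le h), fun v hv hl => H.eqv_gX v hv (hl.trans_le h),
    fun v hv hl a b hab hl' => H.eqv_gK v hv (hl.trans_le h) a b hab (hl'.trans_le h)⟩

lemma EqvBelow.eqv_gI_self (F : FixesLower n y) (H : EqvBelow n y (level v)) (hv : IsUnitVec v)
    (a : Fin (n + 1)) : Eqv y (gI a) v := by
  obtain ⟨k, hk⟩ := hv.exists_isLde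
  rcases Nat.eq_zero_or_pos k with rfl | hpos
  · obtain ⟨c, p, rfl⟩ := hv.eq_single hk.1
    exact F.eqv_gI_single a c p
  obtain ⟨c, hc⟩ := hk.2.resolve_left hpos.ne'
  have H' : EqvBelow n y (level (act (gI a) v)) := by rwa [level_act_gI hv]
  have hlde : IsLde k (act (gI a) v) := by simpa using isLde_act_gI_pow hk a 1
  have hodd : oddSet k (act (gI a) v) = oddSet k v := by simpa using oddSet_act_gI_pow k v a 1
  by_cases ha : a ∈ oddSet k v
  · obtain ⟨b, hb, hba⟩ := exists_ne_mem_oddSet hv hpos hk ha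
    obtain ⟨q, hq⟩ := exists_red hpos hk hba hb ha
    -- `gI a` lowers the required phase by one; starting from `q + 2` keeps the exponent a natural
    -- number. The step on `v` is then the step on `gI a` applied to `v`, preceded by `gI a`.
    have h1 := hq.add_two
    have h2 : Red k (act (gI a) v) b a (q + 1) := by
      refine ⟨hpos, hlde, hba, by rwa [hodd], by rwa [hodd], ?_⟩
      have := h1.cong
      rw [act_gI, act_gI, if_neg hba, if_pos rfl]
      convert this using 1
      ring
    rw [Eqv, H.sig_eq hv h1, H'.sig_eq (hv.act _) h2]
    have : redOp b a (q + 2) = redOp b a (q + 1) * gI a := by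
      rw [redOp, redOp, mul_assoc, ← pow_succ]
    rw [this, via_mul_right, smul_inv_smul]
  · obtain ⟨d, hd, hdc⟩ := exists_ne_mem_oddSet hv hpos hk hc
    obtain ⟨q, hq⟩ := exists_red hpos hk hdc hd hc
    have hca : c ≠ a := fun h => ha (h ▸ hc)
    have hda : d ≠ a := fun h => ha (h ▸ hd)
    have h2 : Red k (act (gI a) v) d c q := by
      refine ⟨hpos, hlde, hdc, by rwa [hodd], by rwa [hodd], ?_⟩
      rw [act_gI, act_gI, if_neg hca, if_neg hda]
      exact hq.cong
    refine Eqv.of_red H H' hv hq h2 ?_ (H.eqv_gI _ (hv.act _) hq.level_lt a)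
    exact (commute_gI_gK hda.symm hca.symm).mul_right ((gI_commute a c).pow_right q)

lemma EqvBelow.eqv_gX_self (F : FixesLower n y) (H : EqvBelow n y (level v)) (hv : IsUnitVec v)
    (a b : Fin (n + 1)) : Eqv y (gX a b) v := by
  obtain ⟨k, hk⟩ := hv.exists_isLde
  rcases Nat.eq_zero_or_pos k with rfl | hpos
  · obtain ⟨c, p, rfl⟩ := hv.eq_single hk.1
    exact F.eqv_gX_single a b c p
  obtain ⟨c, hc⟩ := hk.2.resolve_left hpos.ne'
  have H' : EqvBelow n y (level (act (gX a b) v)) := by rwa [level_act_gX hv]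
  obtain ⟨d, hd, hdc⟩ := exists_ne_mem_oddSet hv hpos hk hc
  obtain ⟨q, hq⟩ := exists_red hpos hk hdc hd hc
  have h2 : Red k (act (gX a b) v) (Equiv.swap a b d) (Equiv.swap a b c) q := by
    refine ⟨hpos, isLde_act_gX hk a b, by simpa using hdc, ?_, ?_, ?_⟩
    · rw [mem_oddSet_act_gX]; simpa using hd
    · rw [mem_oddSet_act_gX]; simpa using hc
    · simpa only [act_gX, Equiv.swap_apply_self] using hq.cong
  refine Eqv.of_red H H' hv hq h2 ?_ (H.eqv_gX _ (hv.act _) hq.level_lt a b)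
  exact (semiconj_gX_gK_apply a b d c).mul_right ((semiconj_gX_gI a b c).pow_right q)

lemma not_ev_I_pow (p : ℕ) : ¬ Ev (I ^ p) := by
  rw [← mul_one (I ^ p), ev_I_pow_mul]
  exact not_ev_one

lemma ev_of_div_mem {z : ℂ} (h : z / gam ∈ zi) : Ev z := ⟨_, h, (mul_div_cancel₀ z gam_ne).symm⟩

/-- Since `K` creates no new denominator, the numerators at `a` and `b` have the same parity. If
both are odd and congruent modulo `gam ^ 2`, the gate is itself a reducing step. If they are odd and
differ by a factor `i`, the relation `gK_mul_gI_cube` applies. If both are even, a reducing step on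
another pair commutes with the gate. -/
lemma EqvBelow.eqv_gK_self (F : FixesLower n y) (H : EqvBelow n y (level v)) (hv : IsUnitVec v)
    {a b : Fin (n + 1)} (hab : a ≠ b) (hle : level (act (gK a b) v) ≤ level v) :
    Eqv y (gK a b) v := by
  obtain ⟨k, hk⟩ := hv.exists_isLde
  have hadm : Adm k (act (gK a b) v) := by
    obtain ⟨l, hl⟩ := (hv.act (gK a b)).exists_isLde
    exact hl.1.mono (isLde_of_level_le hk hl hle)
  have hKa : act (gK a b) v a = (v a + v b) / gam := by rw [act_gK hab, if_pos rfl]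
  have hKb : act (gK a b) v b = (v a - v b) / gam := by
    rw [act_gK hab, if_neg hab.symm, if_pos rfl]
  have hKc : ∀ c, c ≠ a → c ≠ b → act (gK a b) v c = v c := fun c h1 h2 => by
    rw [act_gK hab, if_neg h1, if_neg h2]
  have hsum : Ev (gam ^ k * v a + gam ^ k * v b) := by
    have := hadm a
    rw [hKa, ← mul_div_assoc, mul_add] at this
    exact ev_of_div_mem this
  have H' := H.mono hle
  rcases Nat.eq_zero_or_pos k with rfl | hpos
  · obtain ⟨c, p, rfl⟩ := hv.eq_single hk.1
    by_cases h1 : c = a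
    · subst h1
      rw [Pi.single_eq_same, Pi.single_eq_of_ne hab.symm] at hsum
      exact absurd (by simpa using hsum) (not_ev_I_pow p)
    by_cases h2 : c = b
    · subst h2
      rw [Pi.single_eq_same, Pi.single_eq_of_ne hab] at hsum
      exact absurd (by simpa using hsum) (not_ev_I_pow p)
    exact F.eqv_gK_single hab h1 h2 p
  by_cases ha : a ∈ oddSet k v
  · have hb : b ∈ oddSet k v := by
      rw [mem_oddSet] at *
      intro hb
      apply ha
      simpa using hsum.sub hb
    rcases exists_phase_two (hk.1 a) (hk.1 b) (mem_oddSet.1 ha) (mem_oddSet.1 hb) with h | h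
    · have hr : Red k v a b 0 := ⟨hpos, hk, hab, ha, hb, by simpa using h⟩
      have hop : redOp a b 0 = gK a b := by rw [redOp, pow_zero, mul_one]
      rw [Eqv, H.sig_eq hv hr, hop, via, smul_inv_smul]
    · have hr : Red k v a b 1 := ⟨hpos, hk, hab, ha, hb, by simpa using h⟩
      obtain ⟨t, ht, e⟩ := h
      have hb' := mem_oddSet.1 hb
      have hg : gam = 1 + I := rfl
      -- In this phase the gate leaves both entries odd, and the new pair again reduces with phase
      -- 1.
      have ha2 : a ∈ oddSet k (act (gK a b) v) := by
        rw [mem_oddSet, hKa]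
        rintro ⟨s, hs, e2⟩
        apply hb'
        refine ⟨s - t, zi.sub_mem hs ht, ?_⟩
        rw [← mul_div_assoc, div_eq_iff gam_ne] at e2
        apply mul_left_cancel₀ gam_ne
        linear_combination e2 - e + (gam ^ k * v b) * hg
      have hb2 : b ∈ oddSet k (act (gK a b) v) := by
        rw [mem_oddSet, hKb]
        rintro ⟨s, hs, e2⟩
        apply hb'
        refine ⟨-I * (s - t), zi.mul_mem (zi.neg_mem I_mem_zi) (zi.sub_mem hs ht), ?_⟩
        rw [← mul_div_assoc, div_eq_iff gam_ne] at e2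
        apply mul_left_cancel₀ gam_ne
        linear_combination -I * (e2 - e) + (gam ^ k * v b) * hg + (gam ^ k * v b) * I_sq
      have hr2 : Red k (act (gK a b) v) a b 1 := by
        refine ⟨hpos, ⟨hadm, Or.inr ⟨a, ha2⟩⟩, hab, ha2, hb2, ?_⟩
        refine ⟨-I * t - I * (gam ^ k * v b), zi.sub_mem (zi.mul_mem (zi.neg_mem I_mem_zi) ht)
          (zi.mul_mem I_mem_zi (hk.1 b)), ?_⟩
        rw [hKa, hKb, pow_one]
        have e3 : gam ^ k * ((v a + v b) / gam) - I * (gam ^ k * ((v a - v b) / gam))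
            = gam ^ k * ((1 - I) * v a + (1 + I) * v b) / gam := by ring
        rw [e3, div_eq_iff gam_ne]
        linear_combination -I * gam * e + gam * (gam ^ k * v b) * two_eq
          + (I * (gam ^ k * v a) - gam ^ k * v b) * hg
          + (gam ^ k * v a - gam * (gam ^ k * v b)) * I_sq
      -- The step on `v` with phase 3 is the gate, then the phase-1 step on its result, then `gI b`,
      -- which acts below the level of `v`.
      have hop : redOp a b (1 + 2) = gI b * (redOp a b 1 * gK a b) := by
        rw [redOp, redOp, pow_one, gK_mul_gI_cube hab]
        simp only [mul_assoc]
      have hlow : level (act (redOp a b 1 * gK a b) v) < level v := by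
        rw [act_mul]; exact hr2.level_lt.trans_le hle
      rw [Eqv, H.sig_eq hv hr.add_two, hop, via_mul (H.eqv_gI _ (hv.act _) hlow b), via_mul_right,
        smul_inv_smul, H'.sig_eq (hv.act _) hr2]
  · have ha' : Ev (gam ^ k * v a) := by rwa [mem_oddSet, not_not] at ha
    have hb : b ∉ oddSet k v := by
      rw [mem_oddSet, not_not]
      simpa using hsum.sub ha'
    obtain ⟨c, hc⟩ := hk.2.resolve_left hpos.ne'
    obtain ⟨d, hd, hdc⟩ := exists_ne_mem_oddSet hv hpos hk hc
    obtain ⟨q, hq⟩ := exists_red hpos hk hdc hd hc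
    have hca : c ≠ a := fun h => ha (h ▸ hc)
    have hda : d ≠ a := fun h => ha (h ▸ hd)
    have hcb : c ≠ b := fun h => hb (h ▸ hc)
    have hdb : d ≠ b := fun h => hb (h ▸ hd)
    have hc2 : c ∈ oddSet k (act (gK a b) v) := by
      rw [mem_oddSet, hKc c hca hcb]; exact mem_oddSet.1 hc
    have hd2 : d ∈ oddSet k (act (gK a b) v) := by
      rw [mem_oddSet, hKc d hda hdb]; exact mem_oddSet.1 hd
    have hq2 : Red k (act (gK a b) v) d c q := by
      refine ⟨hpos, ⟨hadm, Or.inr ⟨c, hc2⟩⟩, hdc, hd2, hc2, ?_⟩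
      rw [hKc c hca hcb, hKc d hda hdb]
      exact hq.cong
    have hcomm : Commute (gK a b) (redOp d c q) :=
      (commute_gK_gK hda.symm hca.symm hdb.symm hcb.symm).mul_right
        ((commute_gI_gK hca hcb).symm.pow_right q)
    refine Eqv.of_red H H' hv hq hq2 hcomm (H.eqv_gK _ (hv.act _) hq.level_lt a b hab ?_)
    rw [← act_mul, hcomm.eq, act_mul]
    exact hq2.level_lt.trans_le hle

lemma gK_mul_self {a b : Fin n} (hab : a ≠ b) : gK a b * gK a b = gI a ^ 3 * gI b ^ 3 := by
  have h := gK_sq_mul hab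
  rw [mul_eq_one_iff_eq_inv] at h
  rw [h, ← (gI_commute a b).mul_pow, inv_eq_iff_mul_eq_one, ← pow_succ', (gI_commute a b).mul_pow,
    gI_pow_four, gI_pow_four, one_mul]

/-- Induction on the bound. Up to phases `K` is its own inverse, so it suffices to treat a `K` that
does not raise the level. -/
lemma FixesLower.eqvBelow (F : FixesLower n y) (l : ℕ) : EqvBelow n y l := by
  induction l with
  | zero =>
    exact ⟨fun _ _ h => absurd h (Nat.not_lt_zero _), fun _ _ h => absurd h (Nat.not_lt_zero _),
      fun _ _ h => absurd h (Nat.not_lt_zero _)⟩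
  | succ l H =>
    refine ⟨fun v hv hl a => (H.mono (Nat.lt_succ_iff.1 hl)).eqv_gI_self F hv a,
      fun v hv hl a b => (H.mono (Nat.lt_succ_iff.1 hl)).eqv_gX_self F hv a b,
      fun v hv hl a b hab hl' => ?_⟩
    have Hv := H.mono (Nat.lt_succ_iff.1 hl)
    have HK := H.mono (Nat.lt_succ_iff.1 hl')
    rcases le_or_gt (level (act (gK a b) v)) (level v) with hle | hlt
    · exact Hv.eqv_gK_self F hv hab hle
    -- the step raises the level, so use the step back down
    have hact : act (gK a b) (act (gK a b) v) = act (gI a ^ 3 * gI b ^ 3) v := by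
      rw [← act_mul, gK_mul_self hab]
    have hlev : level (act (gK a b) (act (gK a b) v)) = level v := by
      rw [hact, act_mul, level_act_gI_pow (hv.act _), level_act_gI_pow hv]
    have h1 := HK.eqv_gK_self F (hv.act _) hab (hlev.trans_lt hlt).le
    have h2 := HK.eqv_gI_pow_mul hv hlt a b 3 3
    rw [Eqv, hact, ← h2, ← gK_mul_self hab, mul_smul] at h1
    exact (smul_left_cancel _ h1).symm

/-- The section is equivariant on unit vectors. -/
lemma FixesLower.eqv (F : FixesLower n y) (hv : IsUnitVec v) (g : Pres (n + 1)) : Eqv y g v := by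
  induction g using pres_induction with
  | one => exact eqv_one y v
  | mul g m ih =>
    refine Eqv.mul ?_ ih
    have hw := hv.act m
    cases g with
    | X j k h =>
      rw [← gX_of_lt h]
      exact (F.eqvBelow _).eqv_gX _ hw (Nat.lt_succ_self _) j k
    | K j k h =>
      rw [← gK_of_lt h]
      -- The bound must exceed the levels at both ends of the gate.
      refine (F.eqvBelow (level (act m v) + level (act (gK j k) (act m v)) + 1)).eqv_gK _ hw ?_ j k
        h.ne ?_ <;> omega
    | i j => exact (F.eqvBelow _).eqv_gI _ hw (Nat.lt_succ_self _) j

end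

/-! ### Induction on the dimension: stabilizers, injectivity and surjectivity. -/

section


open Complex

variable {n : ℕ}

/-- A generator, regarded as one of the next larger dimension. -/
def Gen.up : Gen n → Gen (n + 1)
  | .X j k h => .X j.castSucc k.castSucc (Fin.castSucc_lt_castSucc_iff.2 h)
  | .K j k h => .K j.castSucc k.castSucc (Fin.castSucc_lt_castSucc_iff.2 h)
  | .i j => .i j.castSucc

lemma rel_up {w v : FreeMonoid (Gen n)} (h : Rel n w v) :
    Rel (n + 1) (FreeMonoid.map Gen.up w) (FreeMonoid.map Gen.up v) := by
  have ne : ∀ {a b : Fin n}, a ≠ b → a.castSucc ≠ b.castSucc := fun h h' =>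
    h (Fin.castSucc_injective n h')
  have lt : ∀ {a b : Fin n}, a < b → a.castSucc < b.castSucc := Fin.castSucc_lt_castSucc_iff.2
  cases h with
  | i_pow_four j => exact Rel.i_pow_four _
  | X_sq j k a => exact Rel.X_sq _ _ (lt a)
  | K_pow_eight j k a => exact Rel.K_pow_eight _ _ (lt a)
  | i_comm_i j k n1 => exact Rel.i_comm_i _ _ (ne n1)
  | i_comm_X j k l n1 n2 a => exact Rel.i_comm_X _ _ _ (ne n1) (ne n2) (lt a)
  | i_comm_K j k l n1 n2 a => exact Rel.i_comm_K _ _ _ (ne n1) (ne n2) (lt a)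
  | X_comm_X j k l m a b n1 n2 n3 n4 => exact Rel.X_comm_X _ _ _ _ (lt a) (lt b) (ne n1) (ne n2) (ne n3) (ne n4)
  | X_comm_K j k l m a b n1 n2 n3 n4 => exact Rel.X_comm_K _ _ _ _ (lt a) (lt b) (ne n1) (ne n2) (ne n3) (ne n4)
  | K_comm_K j k l m a b n1 n2 n3 n4 => exact Rel.K_comm_K _ _ _ _ (lt a) (lt b) (ne n1) (ne n2) (ne n3) (ne n4)
  | i_swap j k a => exact Rel.i_swap _ _ (lt a)
  | X_swap j k l a b c => exact Rel.X_swap _ _ _ (lt a) (lt b) (lt c)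
  | X_swap' j k l a b c => exact Rel.X_swap' _ _ _ (lt a) (lt b) (lt c)
  | K_swap j k l a b c => exact Rel.K_swap _ _ _ (lt a) (lt b) (lt c)
  | K_swap' j k l a b c => exact Rel.K_swap' _ _ _ (lt a) (lt b) (lt c)
  | K_i_sq j k a => exact Rel.K_i_sq _ _ (lt a)
  | K_i_cube j k a => exact Rel.K_i_cube _ _ (lt a)
  | K_i_i j k a => exact Rel.K_i_i _ _ (lt a)
  | K_sq_i_i j k a => exact Rel.K_sq_i_i _ _ (lt a)
  | K_four j k l m a b c d n1 n2 => exact Rel.K_four _ _ _ _ (lt a) (lt b) (lt c) (lt d) (ne n1) (ne n2)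

/-- The inclusion of the presented group into the one of the next larger dimension. -/
def emb : Pres n →* Pres (n + 1) :=
  (conGen (Rel n)).lift ((conGen (Rel (n + 1))).mk'.comp (FreeMonoid.map Gen.up))
    (Con.conGen_le.2 fun _ _ h => mk_eq_of_rel (rel_up h))

lemma emb_cls (g : Gen n) : emb (cls g) = cls g.up := rfl

lemma emb_gX (a b : Fin n) : emb (gX a b) = gX a.castSucc b.castSucc := by
  unfold gX
  simp only [Fin.castSucc_lt_castSucc_iff]
  split_ifs
  · rfl
  · rfl
  · exact map_one _

lemma emb_gK (a b : Fin n) : emb (gK a b) = gK a.castSucc b.castSucc := by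
  unfold gK
  simp only [Fin.castSucc_lt_castSucc_iff]
  split_ifs
  · rfl
  · rw [map_mul, map_mul, emb_gX]; rfl
  · exact map_one _

lemma vecMap_up (g : Gen n) (v : Fin (n + 1) → ℂ) :
    vecMap g.up.toUnitary v (Fin.last n) = v (Fin.last n) ∧
    ∀ j : Fin n, vecMap g.up.toUnitary v j.castSucc
      = vecMap g.toUnitary (fun i => v i.castSucc) j := by
  have hl : ∀ j : Fin n, Fin.last n ≠ j.castSucc := fun j => (Fin.castSucc_lt_last j).ne'
  cases g <;> simp [Gen.up, vecMap_X, vecMap_K, vecMap_i, hl]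

lemma act_emb (g : Pres n) (v : Fin (n + 1) → ℂ) :
    act (emb g) v (Fin.last n) = v (Fin.last n) ∧
    ∀ j : Fin n, act (emb g) v j.castSucc = act g (fun i => v i.castSucc) j := by
  induction g using pres_induction with
  | one => simp [act_one]
  | mul g m ih =>
    have h := vecMap_up g (act (emb m) v)
    have hc : ∀ v, act (cls g) v = vecMap g.toUnitary v := fun v => by rw [act, toU_cls]
    have hc' : ∀ v, act (cls g.up) v = vecMap g.up.toUnitary v := fun v => by rw [act, toU_cls]
    rw [map_mul, act_mul, act_mul, emb_cls, hc', hc, ← funext ih.2]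
    exact ⟨h.1.trans ih.1, h.2⟩

lemma fixesLower_mk :
    FixesLower n (QuotientGroup.mk 1 : Pres (n + 1) ⧸ (emb (n := n)).range) := by
  have key : ∀ g : Pres n, emb g • (QuotientGroup.mk 1 : Pres (n + 1) ⧸ (emb (n := n)).range)
      = QuotientGroup.mk 1 := by
    intro g
    rw [MulAction.Quotient.smul_mk, QuotientGroup.eq, smul_eq_mul, mul_one, mul_one]
    exact inv_mem ⟨g, rfl⟩
  have ex : ∀ a : Fin (n + 1), a ≠ Fin.last n → ∃ b : Fin n, b.castSucc = a := fun a h =>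
    Fin.exists_castSucc_eq.2 h
  refine ⟨fun a ha => ?_, fun a b ha hb => ?_, fun a b ha hb => ?_⟩
  · obtain ⟨a, rfl⟩ := ex a ha
    exact key (gI a)
  · obtain ⟨a, rfl⟩ := ex a ha
    obtain ⟨b, rfl⟩ := ex b hb
    rw [← emb_gX]; exact key _
  · obtain ⟨a, rfl⟩ := ex a ha
    obtain ⟨b, rfl⟩ := ex b hb
    rw [← emb_gK]; exact key _

/-- The stabilizer of the last basis vector is the presented group of the next lower dimension. -/
lemma mem_range_emb {g : Pres (n + 1)}
    (h : act g (Pi.single (Fin.last n) 1) = Pi.single (Fin.last n) 1) :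
    g ∈ (emb (n := n)).range := by
  set y : Pres (n + 1) ⧸ (emb (n := n)).range := QuotientGroup.mk 1 with hy
  -- The section sends the last basis vector to the trivial coset, so equivariance says that `g`
  -- fixes that coset.
  have he := (fixesLower_mk (n := n)).eqv (isUnitVec_single (Fin.last n)) g
  have hs : sig y (Pi.single (Fin.last n) 1) = y := by
    have := sig_single (y := y) (Fin.last n) 0
    rwa [pow_zero, basePt, pow_zero, one_smul, gX_self, one_smul] at this
  rw [Eqv, h, ← hy, hs, hy, MulAction.Quotient.smul_mk, QuotientGroup.eq, smul_eq_mul,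
    mul_one, mul_one] at he
  exact inv_mem_iff.1 he

lemma pres_zero_eq_one (g : Pres 0) : g = 1 := by
  induction g using pres_induction with
  | one => rfl
  | mul g m ih =>
    cases g with
    | X j _ _ => exact j.elim0
    | K j _ _ => exact j.elim0
    | i j => exact j.elim0

lemma toU_injective : Function.Injective (toU : Pres n →* unitaryDI n) := by
  induction n with
  | zero => exact fun g h _ => (pres_zero_eq_one g).trans (pres_zero_eq_one h).symm
  | succ n ih =>
    rw [injective_iff_map_eq_one]
    intro g hg
    obtain ⟨h, rfl⟩ := mem_range_emb (g := g) (by rw [act, hg, vecMap_one])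
    have : toU h = 1 := by
      refine vecMap_ext fun v => ?_
      ext j
      -- Padding by a last coordinate shows that `h` acts trivially one dimension lower; the value 0
      -- is immaterial.
      have h1 := (act_emb h (Fin.snoc v 0 : Fin (n + 1) → ℂ)).2 j
      rw [act, hg, vecMap_one] at h1
      simp only [Fin.snoc_castSucc] at h1
      rw [vecMap_one, h1, act]
    rw [ih (this.trans (map_one _).symm), map_one]

/-- The presented group acts transitively on unit vectors. -/
lemma exists_act_eq {v : Fin (n + 1) → ℂ} (hv : IsUnitVec v) :
    ∃ g : Pres (n + 1), act g v = Pi.single (Fin.last n) 1 := by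
  induction hl : level v using Nat.strong_induction_on generalizing v with
  | _ l ih =>
    obtain ⟨k, hk⟩ := hv.exists_isLde
    rcases Nat.eq_zero_or_pos k with rfl | hpos
    · obtain ⟨c, p, rfl⟩ := hv.eq_single hk.1
      -- The exponent `3 * p` inverts the phase `I ^ p`, as `I ^ 4 = 1`.
      refine ⟨gX c (Fin.last n) * gI c ^ (3 * p), ?_⟩
      rw [act_mul, act_gI_pow_single, if_pos rfl, act_gX_single, Equiv.swap_apply_left, ← pow_add,
        show 3 * p + p = 4 * p by ring, pow_mul, I_pow_four, one_pow]
    · obtain ⟨c, hc⟩ := hk.2.resolve_left hpos.ne'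
      obtain ⟨d, hd, hdc⟩ := exists_ne_mem_oddSet hv hpos hk hc
      obtain ⟨q, hq⟩ := exists_red hpos hk hdc hd hc
      obtain ⟨g, hg⟩ := ih _ (hl ▸ hq.level_lt) (hv.act _) rfl
      exact ⟨g * redOp d c q, by rw [act_mul, hg]⟩

/-- A unitary matrix that fixes the last basis vector comes from the next lower dimension. -/
lemma exists_lower {W : unitaryDI (n + 1)}
    (hW : vecMap W (Pi.single (Fin.last n) 1) = Pi.single (Fin.last n) 1) :
    ∃ U : unitaryDI n, ∀ v : Fin (n + 1) → ℂ, vecMap W v (Fin.last n) = v (Fin.last n) ∧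
      ∀ j : Fin n, vecMap W v j.castSucc = vecMap U (fun i => v i.castSucc) j := by
  have hinv : vecMap W⁻¹ (Pi.single (Fin.last n) 1) = Pi.single (Fin.last n) 1 := by
    conv_lhs => rw [← hW]
    rw [← vecMap_mul, inv_mul_cancel, vecMap_one]
  have col : ∀ j, W.1.1 j (Fin.last n) = (Pi.single (Fin.last n) 1 : Fin (n + 1) → ℂ) j := by
    intro j
    rw [← hW]; simp [vecMap]
  -- The last row is the conjugate of the last column of the inverse, which fixes the same vector.
  -- So `W` is block diagonal.
  have row : ∀ j, W.1.1 (Fin.last n) j = (Pi.single (Fin.last n) 1 : Fin (n + 1) → ℂ) j := by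
    intro j
    have h1 : star (W.1.1 (Fin.last n) j) = (Pi.single (Fin.last n) 1 : Fin (n + 1) → ℂ) j := by
      rw [← hinv]; simp [vecMap, Matrix.star_apply]
    rw [← star_star (W.1.1 (Fin.last n) j), h1]
    by_cases h : j = Fin.last n
    · subst h; simp
    · simp [h]
  have hl : ∀ j : Fin n, Fin.last n ≠ j.castSucc := fun j => (Fin.castSucc_lt_last j).ne'
  have hl' : ∀ j : Fin n, j.castSucc ≠ Fin.last n := fun j => (hl j).symm
  have hU : W.1.1.submatrix Fin.castSucc Fin.castSucc ∈ Matrix.unitaryGroup (Fin n) ℂ := by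
    rw [Matrix.mem_unitaryGroup_iff]
    ext i j
    have h1 := congrFun (congrFun (Matrix.mem_unitaryGroup_iff.1 W.1.2) i.castSucc) j.castSucc
    rw [Matrix.mul_apply, Fin.sum_univ_castSucc, col, Pi.single_eq_of_ne (hl' i), zero_mul,
      add_zero] at h1
    rw [Matrix.mul_apply]
    refine h1.trans ?_
    simp [Matrix.one_apply]
  refine ⟨⟨⟨_, hU⟩, fun a b => W.2 _ _⟩, fun v => ⟨?_, fun j => ?_⟩⟩
  · change ∑ c, W.1.1 (Fin.last n) c * v c = _
    rw [Fin.sum_univ_castSucc]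
    simp [row, hl']
  · change ∑ c, W.1.1 j.castSucc c * v c = _
    rw [Fin.sum_univ_castSucc, col, Pi.single_eq_of_ne (hl' j), zero_mul, add_zero]
    rfl

lemma toU_surjective : Function.Surjective (toU : Pres n →* unitaryDI n) := by
  induction n with
  | zero =>
    exact fun U => ⟨1, vecMap_ext fun v => funext fun j => j.elim0⟩
  | succ n ih =>
    intro U
    -- `g` moves the last column of `U` back to the last basis vector, leaving a matrix of the next
    -- lower size.
    obtain ⟨g, hg⟩ := exists_act_eq ((isUnitVec_single (Fin.last n)).vecMap U)
    rw [act, ← vecMap_mul] at hg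
    obtain ⟨U', hU'⟩ := exists_lower hg
    obtain ⟨h, rfl⟩ := ih U'
    have : toU (emb h) = toU g * U := by
      refine vecMap_ext fun v => ?_
      ext j
      have h1 := act_emb h v
      refine Fin.lastCases ?_ (fun j => ?_) j
      · exact h1.1.trans (hU' v).1.symm
      · exact (h1.2 j).trans ((hU' v).2 j).symm
    refine ⟨g⁻¹ * emb h, ?_⟩
    rw [map_mul, this, map_inv, inv_mul_cancel_left]

end

end GaussianDyadic

end


theorem theorem3p1 (n : ℕ) :
    GaussianDyadic.IsMonoidPresentation
      (GaussianDyadic.Gen.toUnitary : GaussianDyadic.Gen n → GaussianDyadic.unitaryDI n)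
      (GaussianDyadic.Rel n) where
  injective := GaussianDyadic.toUnitary_injective
  generates := by
    rw [← FreeMonoid.mrange_lift, MonoidHom.mrange_eq_top]
    intro U
    obtain ⟨g, rfl⟩ := GaussianDyadic.toU_surjective U
    induction g using Con.induction_on with
    | H w => exact ⟨w, rfl⟩
  sound w v h := congrArg GaussianDyadic.toU ((Con.eq _).2 h)
  complete w v h := (Con.eq _).1 (GaussianDyadic.toU_injective (n := n)
    (show GaussianDyadic.toU (w : GaussianDyadic.Pres n) = GaussianDyadic.toU v from h))
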